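/- \textbf{Setting.} $\lambda^A$ is the affine, call-by-value $\lambda$-calculus with types $\mathbb N$, $1$, $A\otimes B$, $A\oplus B$, $A\,\&\,B$, $A\multimap B$, lists, trees, $!^k_c A$ (an $A$ usable $k$ times, with $c$ credits attached, $0<k\le\infty$) and $\exists\alpha.A$, where $\alpha$ is a credit variable and $c$ ranges over finite sums of credit variables and natural numbers. Besides the usual terms it has $\mathtt{tick};M$, $\mathtt{create}_c\,M$, $\mathtt{spend}_c;M$, $\mathtt{save}^k_c\,M$, $\mathtt{transfer}$, $\mathtt{pack}$, $\mathtt{unpack}$, and recursors. It is typed by judgments $\Delta\mid\Gamma\vdash_f M:A$ with resource terms $f$, and evaluated by the big-step judgment $M\downarrow^{(n,r)}v$ ($n$ = number of ticks, $r$ = credits created minus credits spent); $M\downarrow v$ means $M\downarrow^{(n,r)}v$ for some $(n,r)$. A value of type $\mathrm{tree}\,B$ is $\mathtt{Emp}$ or $N(e,m,l,r)$ with $e:B$, a cached size $m:\mathbb N$, and $l,r:\mathrm{tree}\,B$. Trees are eliminated by a recursor that matches two levels of the tree (empty; both children empty; exactly one child a node; both children nodes) and supplies each grandchild subtree together with its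 suspended recursive call, of which one or the other may be used. Let $A$ be a closed type and let $\mathit{cmp}:A\otimes A\multimap 1\oplus 1$ be a closed value, using no external credits, that decides a total preorder $\le$ on the closed values of type $A$. Put $\varphi(n)=\lceil\log_2(n+1)\rceil$ and let $|t|$ be the number of nodes of $t$. \textbf{Splay trees.} A \emph{splay tree} is a closed value $t:\mathrm{tree}\,(\exists\alpha.\,!^\infty_\alpha A)$ such that $t$ is a binary search tree with respect to $\le$, and for every subtree $s=N(e,m,l,r)$ of $t$ the cached size $m$ is $|s|$ and the number of credits packed in $e$ is exactly $\varphi(|s|)$. (``Binary search tree'' may be read either with distinct keys or with equal keys allowed on both sides; the result holds for each of the two readings.) \textbf{Split.} $\mathtt{split}$ is the $\lambda^A$ program taking a pivot $p$ (of type $!^\infty_0A$) and a tree, which performs one tick per call and implements the following function. We write $N(x,l,r)$, suppressing credits and sizes. \begin{itemize} \item $\mathtt{split}(p,\mathtt{Emp})=(\mathtt{Emp},\mathtt{Emp})$. \item If $p\le x$: $\mathtt{split}(p,N(x,\mathtt{Emp},c))=(\mathtt{Emp},N(x,\mathtt{Emp},c))$. If $p\le x$ and $p\le y$: $\mathtt{split}(p,N(x,N(y,a,b),c))=(s,\,N(y,g,N(x,b,c)))$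 with $(s,g)=\mathtt{split}(p,a)$. If $p\le x$ and $p\not\le y$: $\mathtt{split}(p,N(x,N(y,a,b),c))=(N(y,a,s),\,N(x,g,c))$ with $(s,g)=\mathtt{split}(p,b)$. \item If $p\not\le x$: $\mathtt{split}(p,N(x,c,\mathtt{Emp}))=(N(x,c,\mathtt{Emp}),\mathtt{Emp})$. If $p\not\le x$ and $p\le z$: $\mathtt{split}(p,N(x,c,N(z,a,b)))=(N(x,c,s),\,N(z,g,b))$ with $(s,g)=\mathtt{split}(p,a)$. If $p\not\le x$ and $p\not\le z$: $\mathtt{split}(p,N(x,c,N(z,a,b)))=(N(z,N(x,c,a),s),\,g)$ with $(s,g)=\mathtt{split}(p,b)$. \end{itemize} Nodes that are kept unchanged keep their credits. In the recursive cases the program spends the credits of the two nodes that are taken apart; for each of the two newly built nodes it computes the size $m$ of its tree from the sizes cached in its subtrees, computes $\varphi(m)$, creates that many credits by a recursion on this number (the function $\mathtt{spawn}:\mathbb N\multimap\exists\alpha.\,!^1_\alpha1$), and stores them in the node. \textbf{Lemma (splay-tree invariant).} Let $p$ be a closed value of type $A$ and let $t:\mathrm{tree}\,(\exists\alpha.\,!^\infty_\alpha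 A)$ be a splay tree. If $\mathtt{split}(\mathtt{save}^\infty_0\,p,\,t)\downarrow(t_0,t_1)$, then $t_0$ and $t_1$ are splay trees. -/

import Mathlib

namespace LambdaA

/-! ## Credit terms

A credit term is a finite sum of credit variables plus a natural number constant, taken up to the
laws of addition.  Credit variables are de Bruijn indices. -/

/-- The credit term `∑ i ∈ vars, αᵢ + const`. -/
@[ext] structure Credit where
  vars : Multiset ℕ
  const : ℕ

namespace Credit

/-- The constant credit term `ℓ`; these are exactly the closed credit terms. -/
def ofNat (n : ℕ) : Credit := ⟨0, n⟩

/-- The credit variable `αᵢ`. -/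
def cvar (i : ℕ) : Credit := ⟨{i}, 0⟩

/-- The sum of two credit terms. -/
def plus (c c' : Credit) : Credit := ⟨c.vars + c'.vars, c.const + c'.const⟩

/-- Simultaneous substitution of credit terms for credit variables. -/
def subst (σ : ℕ → Credit) (c : Credit) : Credit :=
  ⟨c.vars.bind (fun i => (σ i).vars), c.const + (c.vars.map (fun i => (σ i).const)).sum⟩

/-- Weakening by a fresh innermost credit variable. -/
def shift (c : Credit) : Credit := c.subst (fun i => cvar (i + 1))

/-- Extension of a substitution under a binder. -/
def up (σ : ℕ → Credit) : ℕ → Credit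
  | 0 => cvar 0
  | i + 1 => (σ i).shift

/-- The substitution `[c/α]` for the innermost credit variable `α`. -/
def inst (c : Credit) : ℕ → Credit
  | 0 => c
  | i + 1 => cvar i

/-- `Δ ⊢ c credit`, where `Δ` consists of `d` credit variables. -/
def WF (d : ℕ) (c : Credit) : Prop := ∀ i ∈ c.vars, i < d

end Credit

/-! ## Types -/

/-- The types of `λ^A` with trees and credit existentials. -/
inductive Ty : Type
  /-- natural numbers -/
  | nat : Ty
  /-- the unit type `1` -/
  | one : Ty
  /-- `A ⊗ B` -/
  | tensor : Ty → Ty → Ty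
  /-- `A ⊕ B` -/
  | plus : Ty → Ty → Ty
  /-- the lazy product `A & B` -/
  | amp : Ty → Ty → Ty
  /-- `A ⊸ B` -/
  | lolli : Ty → Ty → Ty
  /-- lists -/
  | list : Ty → Ty
  /-- trees -/
  | tree : Ty → Ty
  /-- `!^k_c A`: an `A` that can be used `k` times, with `c` credits attached -/
  | bang : ℕ∞ → Credit → Ty → Ty
  /-- `∃ α. A`; binds the innermost credit variable of `A` -/
  | ex : Ty → Ty

namespace Ty

/-- Simultaneous substitution of credit terms in a type. -/
def subst : (ℕ → Credit) → Ty → Ty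
  | _, nat => nat
  | _, one => one
  | σ, tensor A B => tensor (A.subst σ) (B.subst σ)
  | σ, plus A B => plus (A.subst σ) (B.subst σ)
  | σ, amp A B => amp (A.subst σ) (B.subst σ)
  | σ, lolli A B => lolli (A.subst σ) (B.subst σ)
  | σ, list A => list (A.subst σ)
  | σ, tree A => tree (A.subst σ)
  | σ, bang k c A => bang k (c.subst σ) (A.subst σ)
  | σ, ex A => ex (A.subst (Credit.up σ))

/-- Weakening of a type by a fresh innermost credit variable. -/
def shift (A : Ty) : Ty := A.subst (fun i => Credit.cvar (i + 1))

/-- Well-formedness of a type over `d` credit variables; multiplicities are positive or `∞`. -/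
def WF : ℕ → Ty → Prop
  | _, nat => True
  | _, one => True
  | d, tensor A B => A.WF d ∧ B.WF d
  | d, plus A B => A.WF d ∧ B.WF d
  | d, amp A B => A.WF d ∧ B.WF d
  | d, lolli A B => A.WF d ∧ B.WF d
  | d, list A => A.WF d
  | d, tree A => A.WF d
  | d, bang k c A => 0 < k ∧ c.WF d ∧ A.WF d
  | d, ex A => A.WF (d + 1)

end Ty

/-! ## Terms -/

/-- The terms of `λ^A` with trees and credit existentials.  Term variables are names (natural
numbers); credit variables are de Bruijn indices, bound by `unpack`. -/
inductive Tm : Type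
  | var : ℕ → Tm
  /-- `λ x. M` -/
  | lam : ℕ → Tm → Tm
  | app : Tm → Tm → Tm
  /-- `()` -/
  | unit : Tm
  /-- the eager pair `(M, N)` -/
  | pair : Tm → Tm → Tm
  /-- `letPair k' x y M N`: match `k'` copies of `M` with `(x, y)` in `N` -/
  | letPair : ℕ∞ → ℕ → ℕ → Tm → Tm → Tm
  | inl : Tm → Tm
  | inr : Tm → Tm
  /-- `caseOf k' M x N₁ y N₂`: match `k'` copies of `M` with `inl x => N₁` and `inr y => N₂` -/
  | caseOf : ℕ∞ → Tm → ℕ → Tm → ℕ → Tm → Tm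
  /-- the lazy pair `⟨M, N⟩` -/
  | lazyPair : Tm → Tm → Tm
  | fst : Tm → Tm
  | snd : Tm → Tm
  | zero : Tm
  | succ : Tm → Tm
  /-- the recursor on natural numbers: argument, thunked base case, saved step function -/
  | nrec : Tm → Tm → Tm → Tm
  | nil : Tm
  | cons : Tm → Tm → Tm
  /-- the recursor on lists: argument, thunked base case, saved step function -/
  | lrec : Tm → Tm → Tm → Tm
  /-- `tick; M` -/
  | tick : Tm → Tm
  /-- `create_c M` -/
  | create : Credit → Tm → Tm
  /-- `spend_c; M` -/
  | spend : Credit → Tm → Tm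
  /-- `save^k_c M` -/
  | save : ℕ∞ → Credit → Tm → Tm
  /-- `transfer k' k c x M N` is `transfer_{k'} !^k_c x = M to N` -/
  | transfer : ℕ∞ → ℕ∞ → Credit → ℕ → Tm → Tm → Tm
  /-- `pack α = c with M` -/
  | pack : Credit → Tm → Tm
  /-- `unpack x M N` is `unpack (α, x) = M in N`; it binds `α` as the innermost credit variable
  of `N` -/
  | unpack : ℕ → Tm → Tm → Tm
  /-- the empty tree -/
  | emp : Tm
  /-- `node e m l r`: the tree with element `e`, cached size `m` and subtrees `l`, `r` -/
  | node : Tm → Tm → Tm → Tm → Tm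
  /-- the two-level tree recursor: argument; thunked case for the empty tree; saved cases for a
  node with two empty children, with a node as left child only, with a node as right child only,
  and with two nodes as children -/
  | trec : Tm → Tm → Tm → Tm → Tm → Tm → Tm

namespace Tm

/-- Substitution of credit terms for credit variables in a term. -/
def csubst : (ℕ → Credit) → Tm → Tm
  | _, var y => var y
  | σ, lam y M => lam y (M.csubst σ)
  | σ, app M N => app (M.csubst σ) (N.csubst σ)
  | _, unit => unit
  | σ, pair M N => pair (M.csubst σ) (N.csubst σ)
  | σ, letPair k' y z M N => letPair k' y z (M.csubst σ) (N.csubst σ)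
  | σ, inl M => inl (M.csubst σ)
  | σ, inr M => inr (M.csubst σ)
  | σ, caseOf k' M y N₁ z N₂ => caseOf k' (M.csubst σ) y (N₁.csubst σ) z (N₂.csubst σ)
  | σ, lazyPair M N => lazyPair (M.csubst σ) (N.csubst σ)
  | σ, fst M => fst (M.csubst σ)
  | σ, snd M => snd (M.csubst σ)
  | _, zero => zero
  | σ, succ M => succ (M.csubst σ)
  | σ, nrec M N₁ N₂ => nrec (M.csubst σ) (N₁.csubst σ) (N₂.csubst σ)
  | _, nil => nil
  | σ, cons M N => cons (M.csubst σ) (N.csubst σ)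
  | σ, lrec M N₁ N₂ => lrec (M.csubst σ) (N₁.csubst σ) (N₂.csubst σ)
  | σ, tick M => tick (M.csubst σ)
  | σ, create c M => create (c.subst σ) (M.csubst σ)
  | σ, spend c M => spend (c.subst σ) (M.csubst σ)
  | σ, save k c M => save k (c.subst σ) (M.csubst σ)
  | σ, transfer k' k c y M N => transfer k' k (c.subst σ) y (M.csubst σ) (N.csubst σ)
  | σ, pack c M => pack (c.subst σ) (M.csubst σ)
  | σ, unpack y M N => unpack y (M.csubst σ) (N.csubst (Credit.up σ))
  | _, emp => emp
  | σ, node M N L R => node (M.csubst σ) (N.csubst σ) (L.csubst σ) (R.csubst σ)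
  | σ, trec M N₀ N₁ N₂ N₃ N₄ => trec (M.csubst σ) (N₀.csubst σ) (N₁.csubst σ) (N₂.csubst σ)
      (N₃.csubst σ) (N₄.csubst σ)

/-- `M.subst x v` is `M[v/x]`.  Evaluation substitutes only closed values `v`, so no variable of
`v` can be captured. -/
def subst (M : Tm) (x : ℕ) (v : Tm) : Tm :=
  match M with
  | var y => if y = x then v else var y
  | lam y M => lam y (if y = x then M else M.subst x v)
  | app M N => app (M.subst x v) (N.subst x v)
  | unit => unit
  | pair M N => pair (M.subst x v) (N.subst x v)
  | letPair k' y z M N =>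
      letPair k' y z (M.subst x v) (if y = x ∨ z = x then N else N.subst x v)
  | inl M => inl (M.subst x v)
  | inr M => inr (M.subst x v)
  | caseOf k' M y N₁ z N₂ =>
      caseOf k' (M.subst x v) y (if y = x then N₁ else N₁.subst x v)
        z (if z = x then N₂ else N₂.subst x v)
  | lazyPair M N => lazyPair (M.subst x v) (N.subst x v)
  | fst M => fst (M.subst x v)
  | snd M => snd (M.subst x v)
  | zero => zero
  | succ M => succ (M.subst x v)
  | nrec M N₁ N₂ => nrec (M.subst x v) (N₁.subst x v) (N₂.subst x v)
  | nil => nil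
  | cons M N => cons (M.subst x v) (N.subst x v)
  | lrec M N₁ N₂ => lrec (M.subst x v) (N₁.subst x v) (N₂.subst x v)
  | tick M => tick (M.subst x v)
  | create c M => create c (M.subst x v)
  | spend c M => spend c (M.subst x v)
  | save k c M => save k c (M.subst x v)
  | transfer k' k c y M N =>
      transfer k' k c y (M.subst x v) (if y = x then N else N.subst x v)
  | pack c M => pack c (M.subst x v)
  | unpack y M N => unpack y (M.subst x v) (if y = x then N else N.subst x v)
  | emp => emp
  | node M N L R => node (M.subst x v) (N.subst x v) (L.subst x v) (R.subst x v)
  | trec M N₀ N₁ N₂ N₃ N₄ => trec (M.subst x v) (N₀.subst x v) (N₁.subst x v) (N₂.subst x v)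
      (N₃.subst x v) (N₄.subst x v)

/-- The values of `λ^A`. -/
inductive IsValue : Tm → Prop
  | lam (x : ℕ) (M : Tm) : IsValue (lam x M)
  | unit : IsValue unit
  | pair {u v : Tm} : IsValue u → IsValue v → IsValue (pair u v)
  | inl {v : Tm} : IsValue v → IsValue (inl v)
  | inr {v : Tm} : IsValue v → IsValue (inr v)
  | lazyPair (M N : Tm) : IsValue (lazyPair M N)
  | zero : IsValue zero
  | succ {v : Tm} : IsValue v → IsValue (succ v)
  | nil : IsValue nil
  | cons {u v : Tm} : IsValue u → IsValue v → IsValue (cons u v)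
  | save (k : ℕ∞) (l : ℕ) {v : Tm} : IsValue v → IsValue (save k (Credit.ofNat l) v)
  | pack (l : ℕ) {v : Tm} : IsValue v → IsValue (pack (Credit.ofNat l) v)
  | emp : IsValue emp
  | node {e m l r : Tm} :
      IsValue e → IsValue m → IsValue l → IsValue r → IsValue (node e m l r)

/-- The numeral `S (S (… 0))`. -/
def num : ℕ → Tm
  | 0 => zero
  | n + 1 => succ (num n)

end Tm

open Tm

/-! ## Typing -/

/-- Contexts `Γ`: partial maps from names to types. -/
abbrev Ctx : Type := ℕ → Option Ty

/-- `Γ, x : A`. -/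
def Ctx.bind (Γ : Ctx) (x : ℕ) (A : Ty) : Ctx := Function.update Γ x (some A)

/-- Weakening of a context by a fresh innermost credit variable. -/
def Ctx.shift (Γ : Ctx) : Ctx := fun x => (Γ x).map Ty.shift

/-- The empty context. -/
def Ctx.empty : Ctx := fun _ => none

/-- Resource terms `∑ aₓ x + ∑ bᵢ αᵢ + ℓ`, given by the coefficients of the term variables, the
coefficients of the credit variables, and the constant, all in `ℕ ∪ {∞}`.  Addition, scaling and
order are coefficientwise. -/
abbrev Res : Type := (ℕ → ℕ∞) × (ℕ → ℕ∞) × ℕ∞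

/-- The resource term `x`. -/
def Res.use (x : ℕ) : Res := (Pi.single x 1, 0, 0)

/-- The resource term consisting of a credit term only. -/
def Res.ofCredit (c : Credit) : Res := (0, fun i => (c.vars.count i : ℕ∞), (c.const : ℕ∞))

/-- The resource term consisting of a bank of `a` credits only. -/
def Res.bank (a : ℕ∞) : Res := (0, 0, a)

/-- `f + a x` for a newly bound `x`. -/
def Res.bind (f : Res) (x : ℕ) (a : ℕ∞) : Res := (Function.update f.1 x a, f.2)

/-- Weakening of a resource term by a fresh innermost credit variable. -/
def Res.shift (f : Res) : Res :=
  (f.1, fun i => match i with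
    | 0 => 0
    | i + 1 => f.2.1 i, f.2.2)

/-- The type `(A ⊗ ℕ) ⊗ ((tree A & C) ⊗ (tree A & C))` of the data that the tree recursor with
result type `C` supplies for a child that is a node. -/
def childTy (A C : Ty) : Ty :=
  .tensor (.tensor A .nat) (.tensor (.amp (.tree A) C) (.amp (.tree A) C))

/-- The typing judgment `Δ | Γ ⊢_f M : A`, where `Δ` consists of `d` credit variables. -/
inductive HasType : ℕ → Ctx → Res → Tm → Ty → Prop
  | var {d : ℕ} {Γ : Ctx} {f : Res} {x : ℕ} {A : Ty} :
      Γ x = some A → Res.use x ≤ f → HasType d Γ f (.var x) A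
  | lam {d : ℕ} {Γ : Ctx} {f : Res} {x : ℕ} {M : Tm} {A B : Ty} :
      A.WF d → HasType d (Γ.bind x A) (f.bind x 1) M B → HasType d Γ f (.lam x M) (.lolli A B)
  | app {d : ℕ} {Γ : Ctx} {f g : Res} {M N : Tm} {A B : Ty} :
      HasType d Γ f M (.lolli A B) → HasType d Γ g N A → HasType d Γ (f + g) (.app M N) B
  | unit {d : ℕ} {Γ : Ctx} {f : Res} : HasType d Γ f .unit .one
  | pair {d : ℕ} {Γ : Ctx} {f g : Res} {M N : Tm} {A B : Ty} :
      HasType d Γ f M A → HasType d Γ g N B → HasType d Γ (f + g) (.pair M N) (.tensor A B)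
  | letPair {d : ℕ} {Γ : Ctx} {f g : Res} {k' : ℕ∞} {x y : ℕ} {M N : Tm} {A B C : Ty} :
      0 < k' → HasType d Γ f M (.tensor A B) →
      HasType d ((Γ.bind x A).bind y B) ((g.bind x k').bind y k') N C →
      HasType d Γ (k' • f + g) (.letPair k' x y M N) C
  | inl {d : ℕ} {Γ : Ctx} {f : Res} {M : Tm} {A B : Ty} :
      B.WF d → HasType d Γ f M A → HasType d Γ f (.inl M) (.plus A B)
  | inr {d : ℕ} {Γ : Ctx} {f : Res} {M : Tm} {A B : Ty} :
      A.WF d → HasType d Γ f M B → HasType d Γ f (.inr M) (.plus A B)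
  | caseOf {d : ℕ} {Γ : Ctx} {f g : Res} {k' : ℕ∞} {x y : ℕ} {M N₁ N₂ : Tm} {A B C : Ty} :
      0 < k' → HasType d Γ f M (.plus A B) →
      HasType d (Γ.bind x A) (g.bind x k') N₁ C →
      HasType d (Γ.bind y B) (g.bind y k') N₂ C →
      HasType d Γ (k' • f + g) (.caseOf k' M x N₁ y N₂) C
  | lazyPair {d : ℕ} {Γ : Ctx} {f : Res} {M N : Tm} {A B : Ty} :
      HasType d Γ f M A → HasType d Γ f N B → HasType d Γ f (.lazyPair M N) (.amp A B)
  | fst {d : ℕ} {Γ : Ctx} {f : Res} {M : Tm} {A B : Ty} :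
      HasType d Γ f M (.amp A B) → HasType d Γ f (.fst M) A
  | snd {d : ℕ} {Γ : Ctx} {f : Res} {M : Tm} {A B : Ty} :
      HasType d Γ f M (.amp A B) → HasType d Γ f (.snd M) B
  | zero {d : ℕ} {Γ : Ctx} {f : Res} : HasType d Γ f .zero .nat
  | succ {d : ℕ} {Γ : Ctx} {f : Res} {M : Tm} :
      HasType d Γ f M .nat → HasType d Γ f (.succ M) .nat
  | nrec {d : ℕ} {Γ : Ctx} {f g h : Res} {M N₁ N₂ : Tm} {C : Ty} :
      HasType d Γ f M .nat → HasType d Γ g N₁ (.lolli .one C) →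
      HasType d Γ h N₂
        (.bang ⊤ (Credit.ofNat 0) (.lolli (.tensor .nat (.lolli .one C)) C)) →
      HasType d Γ (f + g + h) (.nrec M N₁ N₂) C
  | nil {d : ℕ} {Γ : Ctx} {f : Res} {A : Ty} : A.WF d → HasType d Γ f .nil (.list A)
  | cons {d : ℕ} {Γ : Ctx} {f g : Res} {M N : Tm} {A : Ty} :
      HasType d Γ f M A → HasType d Γ g N (.list A) → HasType d Γ (f + g) (.cons M N) (.list A)
  | lrec {d : ℕ} {Γ : Ctx} {f g h : Res} {M N₁ N₂ : Tm} {A C : Ty} :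
      HasType d Γ f M (.list A) → HasType d Γ g N₁ (.lolli .one C) →
      HasType d Γ h N₂
        (.bang ⊤ (Credit.ofNat 0) (.lolli (.tensor A (.amp (.list A) C)) C)) →
      HasType d Γ (f + g + h) (.lrec M N₁ N₂) C
  | tick {d : ℕ} {Γ : Ctx} {f : Res} {M : Tm} {A : Ty} :
      HasType d Γ f M A → HasType d Γ f (.tick M) A
  | create {d : ℕ} {Γ : Ctx} {f : Res} {c : Credit} {M : Tm} {A : Ty} :
      c.WF d → HasType d Γ (f + Res.ofCredit c) M A → HasType d Γ f (.create c M) A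
  | spend {d : ℕ} {Γ : Ctx} {f : Res} {c : Credit} {M : Tm} {A : Ty} :
      c.WF d → HasType d Γ f M A → HasType d Γ (f + Res.ofCredit c) (.spend c M) A
  | save {d : ℕ} {Γ : Ctx} {f g : Res} {k : ℕ∞} {c : Credit} {M : Tm} {A : Ty} :
      0 < k → c.WF d → HasType d Γ f M A → k • f + Res.ofCredit c ≤ g →
      HasType d Γ g (.save k c M) (.bang k c A)
  | transfer {d : ℕ} {Γ : Ctx} {f g : Res} {k' k : ℕ∞} {c : Credit} {x : ℕ} {M N : Tm}
      {A C : Ty} :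
      0 < k' → c.WF d → HasType d Γ f M (.bang k c A) →
      HasType d (Γ.bind x A) ((g + k' • Res.ofCredit c).bind x (k' * k)) N C →
      HasType d Γ (k' • f + g) (.transfer k' k c x M N) C
  | pack {d : ℕ} {Γ : Ctx} {f : Res} {c : Credit} {M : Tm} {A : Ty} :
      c.WF d → (Ty.ex A).WF d → HasType d Γ f M (A.subst (Credit.inst c)) →
      HasType d Γ f (.pack c M) (.ex A)
  | unpack {d : ℕ} {Γ : Ctx} {f g : Res} {x : ℕ} {M N : Tm} {A C : Ty} :
      HasType d Γ f M (.ex A) →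
      HasType (d + 1) (Γ.shift.bind x A) (g.shift.bind x 1) N C.shift →
      HasType d Γ (f + g) (.unpack x M N) C
  | emp {d : ℕ} {Γ : Ctx} {f : Res} {A : Ty} : A.WF d → HasType d Γ f .emp (.tree A)
  | node {d : ℕ} {Γ : Ctx} {f g h j : Res} {M N L R : Tm} {A : Ty} :
      HasType d Γ f M A → HasType d Γ g N .nat → HasType d Γ h L (.tree A) →
      HasType d Γ j R (.tree A) → HasType d Γ (f + g + h + j) (.node M N L R) (.tree A)
  | trec {d : ℕ} {Γ : Ctx} {f g h₁ h₂ h₃ h₄ : Res} {M N₀ N₁ N₂ N₃ N₄ : Tm} {A C : Ty} :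
      HasType d Γ f M (.tree A) → HasType d Γ g N₀ (.lolli .one C) →
      HasType d Γ h₁ N₁ (.bang ⊤ (Credit.ofNat 0) (.lolli (.tensor A .nat) C)) →
      HasType d Γ h₂ N₂ (.bang ⊤ (Credit.ofNat 0)
        (.lolli (.tensor (.tensor A .nat) (childTy A C)) C)) →
      HasType d Γ h₃ N₃ (.bang ⊤ (Credit.ofNat 0)
        (.lolli (.tensor (.tensor A .nat) (childTy A C)) C)) →
      HasType d Γ h₄ N₄ (.bang ⊤ (Credit.ofNat 0)
        (.lolli (.tensor (.tensor A .nat) (.tensor (childTy A C) (childTy A C))) C)) →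
      HasType d Γ (f + g + h₁ + h₂ + h₃ + h₄) (.trec M N₀ N₁ N₂ N₃ N₄) C

/-- `v` is a closed value of type `A` (with some number of credits). -/
def IsClosedValue (A : Ty) (v : Tm) : Prop :=
  v.IsValue ∧ ∃ a : ℕ∞, HasType 0 Ctx.empty (Res.bank a) v A

/-! ## Operational semantics -/

/-- The saved step function `save^∞_0 (λ x. N)` of a recursor. -/
def savedFun (x : ℕ) (N : Tm) : Tm := .save ⊤ (Credit.ofNat 0) (.lam x N)

/-- The data `((y, m), (⟨l, rec l⟩, ⟨r, rec r⟩))` that the tree recursor supplies for a child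
`node y m l r`, where `rec` is the suspended recursive call. -/
def childData (recCall : Tm → Tm) (y m l r : Tm) : Tm :=
  .pair (.pair y m) (.pair (.lazyPair l (recCall l)) (.lazyPair r (recCall r)))

/-- One unfolding of the tree recursor on a tree value: the branch selected by the two-level
match, instantiated. The branches are given by a bound variable and a body. -/
def treeUnfold (x₀ : ℕ) (N₀ : Tm) (x₁ : ℕ) (N₁ : Tm) (x₂ : ℕ) (N₂ : Tm) (x₃ : ℕ) (N₃ : Tm)
    (x₄ : ℕ) (N₄ : Tm) (t : Tm) : Option Tm :=
  let recCall : Tm → Tm := fun s => .trec s (.lam x₀ N₀) (savedFun x₁ N₁) (savedFun x₂ N₂)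
    (savedFun x₃ N₃) (savedFun x₄ N₄)
  match t with
  | .emp => some (N₀.subst x₀ .unit)
  | .node x n .emp .emp => some (N₁.subst x₁ (.pair x n))
  | .node x n (.node y m l r) .emp =>
      some (N₂.subst x₂ (.pair (.pair x n) (childData recCall y m l r)))
  | .node x n .emp (.node y m l r) =>
      some (N₃.subst x₃ (.pair (.pair x n) (childData recCall y m l r)))
  | .node x n (.node y m l r) (.node y' m' l' r') =>
      some (N₄.subst x₄ (.pair (.pair x n)
        (.pair (childData recCall y m l r) (childData recCall y' m' l' r'))))
  | _ => none

/-- Multiplication of a credit effect by a multiplicity. -/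
noncomputable def scale (k : ℕ∞) (r : EReal) : EReal := ((k : ENNReal) : EReal) * r

/-- The big-step judgment `M ↓^(n,r) v`: `M` evaluates to `v` with real cost `n` (number of ticks)
and credit effect `r` (credits created minus credits spent).  As multiplicities may be infinite,
`r` is taken in the extended reals. -/
inductive Eval : Tm → ℕ → EReal → Tm → Prop
  | lam {x : ℕ} {M : Tm} : Eval (.lam x M) 0 0 (.lam x M)
  | app {M N M' u v : Tm} {x n₁ n₂ n₃ : ℕ} {r₁ r₂ r₃ : EReal} :
      Eval M n₁ r₁ (.lam x M') → Eval N n₂ r₂ u → Eval (M'.subst x u) n₃ r₃ v →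
      Eval (.app M N) (n₁ + n₂ + n₃) (r₁ + r₂ + r₃) v
  | unit : Eval .unit 0 0 .unit
  | pair {M N u v : Tm} {n₁ n₂ : ℕ} {r₁ r₂ : EReal} :
      Eval M n₁ r₁ u → Eval N n₂ r₂ v → Eval (.pair M N) (n₁ + n₂) (r₁ + r₂) (.pair u v)
  | letPair {k' : ℕ∞} {x y : ℕ} {M N u w v : Tm} {n₁ n₂ : ℕ} {r₁ r₂ : EReal} :
      Eval M n₁ r₁ (.pair u w) → Eval ((N.subst y w).subst x u) n₂ r₂ v →
      Eval (.letPair k' x y M N) (n₁ + n₂) (scale k' r₁ + r₂) v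
  | inl {M v : Tm} {n : ℕ} {r : EReal} : Eval M n r v → Eval (.inl M) n r (.inl v)
  | inr {M v : Tm} {n : ℕ} {r : EReal} : Eval M n r v → Eval (.inr M) n r (.inr v)
  | case_inl {k' : ℕ∞} {x y : ℕ} {M N₁ N₂ u v : Tm} {n₁ n₂ : ℕ} {r₁ r₂ : EReal} :
      Eval M n₁ r₁ (.inl u) → Eval (N₁.subst x u) n₂ r₂ v →
      Eval (.caseOf k' M x N₁ y N₂) (n₁ + n₂) (scale k' r₁ + r₂) v
  | case_inr {k' : ℕ∞} {x y : ℕ} {M N₁ N₂ u v : Tm} {n₁ n₂ : ℕ} {r₁ r₂ : EReal} :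
      Eval M n₁ r₁ (.inr u) → Eval (N₂.subst y u) n₂ r₂ v →
      Eval (.caseOf k' M x N₁ y N₂) (n₁ + n₂) (scale k' r₁ + r₂) v
  | lazyPair {M N : Tm} : Eval (.lazyPair M N) 0 0 (.lazyPair M N)
  | fst {M M₁ M₂ v : Tm} {n₁ n₂ : ℕ} {r₁ r₂ : EReal} :
      Eval M n₁ r₁ (.lazyPair M₁ M₂) → Eval M₁ n₂ r₂ v → Eval (.fst M) (n₁ + n₂) (r₁ + r₂) v
  | snd {M M₁ M₂ v : Tm} {n₁ n₂ : ℕ} {r₁ r₂ : EReal} :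
      Eval M n₁ r₁ (.lazyPair M₁ M₂) → Eval M₂ n₂ r₂ v → Eval (.snd M) (n₁ + n₂) (r₁ + r₂) v
  | zero : Eval .zero 0 0 .zero
  | succ {M v : Tm} {n : ℕ} {r : EReal} : Eval M n r v → Eval (.succ M) n r (.succ v)
  | nrec_zero {M N₁ N₂ N₁' N₂' v : Tm} {x y n₁ n₂ n₃ n₄ : ℕ} {r₁ r₂ r₃ r₄ : EReal} :
      Eval M n₁ r₁ .zero → Eval N₁ n₂ r₂ (.lam x N₁') → Eval N₂ n₃ r₃ (savedFun y N₂') →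
      Eval (N₁'.subst x .unit) n₄ r₄ v →
      Eval (.nrec M N₁ N₂) (n₁ + n₂ + n₃ + n₄) (r₁ + r₂ + r₃ + r₄) v
  | nrec_succ {M N₁ N₂ N₁' N₂' u v : Tm} {x y n₁ n₂ n₃ n₄ : ℕ} {r₁ r₂ r₃ r₄ : EReal} :
      Eval M n₁ r₁ (.succ u) → Eval N₁ n₂ r₂ (.lam x N₁') → Eval N₂ n₃ r₃ (savedFun y N₂') →
      Eval (N₂'.subst y (.pair u (.lam 0 (.nrec u (.lam x N₁') (savedFun y N₂'))))) n₄ r₄ v →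
      Eval (.nrec M N₁ N₂) (n₁ + n₂ + n₃ + n₄) (r₁ + r₂ + r₃ + r₄) v
  | nil : Eval .nil 0 0 .nil
  | cons {M N u v : Tm} {n₁ n₂ : ℕ} {r₁ r₂ : EReal} :
      Eval M n₁ r₁ u → Eval N n₂ r₂ v → Eval (.cons M N) (n₁ + n₂) (r₁ + r₂) (.cons u v)
  | lrec_nil {M N₁ N₂ N₁' N₂' v : Tm} {x y n₁ n₂ n₃ n₄ : ℕ} {r₁ r₂ r₃ r₄ : EReal} :
      Eval M n₁ r₁ .nil → Eval N₁ n₂ r₂ (.lam x N₁') → Eval N₂ n₃ r₃ (savedFun y N₂') →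
      Eval (N₁'.subst x .unit) n₄ r₄ v →
      Eval (.lrec M N₁ N₂) (n₁ + n₂ + n₃ + n₄) (r₁ + r₂ + r₃ + r₄) v
  | lrec_cons {M N₁ N₂ N₁' N₂' u w v : Tm} {x y n₁ n₂ n₃ n₄ : ℕ} {r₁ r₂ r₃ r₄ : EReal} :
      Eval M n₁ r₁ (.cons u w) → Eval N₁ n₂ r₂ (.lam x N₁') → Eval N₂ n₃ r₃ (savedFun y N₂') →
      Eval (N₂'.subst y (.pair u (.lazyPair w (.lrec w (.lam x N₁') (savedFun y N₂'))))) n₄ r₄ v →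
      Eval (.lrec M N₁ N₂) (n₁ + n₂ + n₃ + n₄) (r₁ + r₂ + r₃ + r₄) v
  | tick {M v : Tm} {n : ℕ} {r : EReal} : Eval M n r v → Eval (.tick M) (n + 1) r v
  | create {l : ℕ} {M v : Tm} {n : ℕ} {r : EReal} :
      Eval M n r v → Eval (.create (Credit.ofNat l) M) n (r + (l : EReal)) v
  | spend {l : ℕ} {M v : Tm} {n : ℕ} {r : EReal} :
      Eval M n r v → Eval (.spend (Credit.ofNat l) M) n (r - (l : EReal)) v
  | save {k : ℕ∞} {l : ℕ} {M v : Tm} {n : ℕ} {r : EReal} :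
      Eval M n r v →
      Eval (.save k (Credit.ofNat l) M) n (scale k r) (.save k (Credit.ofNat l) v)
  | transfer {k' k : ℕ∞} {l x : ℕ} {M N u v : Tm} {n₁ n₂ : ℕ} {r₁ r₂ : EReal} :
      Eval M n₁ r₁ (.save k (Credit.ofNat l) u) → Eval (N.subst x u) n₂ r₂ v →
      Eval (.transfer k' k (Credit.ofNat l) x M N) (n₁ + n₂) (scale k' r₁ + r₂) v
  | pack {l : ℕ} {M v : Tm} {n : ℕ} {r : EReal} :
      Eval M n r v → Eval (.pack (Credit.ofNat l) M) n r (.pack (Credit.ofNat l) v)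
  | unpack {l x : ℕ} {M N u v : Tm} {n₁ n₂ : ℕ} {r₁ r₂ : EReal} :
      Eval M n₁ r₁ (.pack (Credit.ofNat l) u) →
      Eval ((N.csubst (Credit.inst (Credit.ofNat l))).subst x u) n₂ r₂ v →
      Eval (.unpack x M N) (n₁ + n₂) (r₁ + r₂) v
  | emp : Eval .emp 0 0 .emp
  | node {M N L R e m l r : Tm} {n₁ n₂ n₃ n₄ : ℕ} {r₁ r₂ r₃ r₄ : EReal} :
      Eval M n₁ r₁ e → Eval N n₂ r₂ m → Eval L n₃ r₃ l → Eval R n₄ r₄ r →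
      Eval (.node M N L R) (n₁ + n₂ + n₃ + n₄) (r₁ + r₂ + r₃ + r₄) (.node e m l r)
  | trec {M N₀ N₁ N₂ N₃ N₄ N₀' N₁' N₂' N₃' N₄' t K v : Tm} {x₀ x₁ x₂ x₃ x₄ : ℕ}
      {n n₀ n₁ n₂ n₃ n₄ n' : ℕ} {r r₀ r₁ r₂ r₃ r₄ r' : EReal} :
      Eval M n r t → Eval N₀ n₀ r₀ (.lam x₀ N₀') → Eval N₁ n₁ r₁ (savedFun x₁ N₁') →
      Eval N₂ n₂ r₂ (savedFun x₂ N₂') → Eval N₃ n₃ r₃ (savedFun x₃ N₃') →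
      Eval N₄ n₄ r₄ (savedFun x₄ N₄') →
      treeUnfold x₀ N₀' x₁ N₁' x₂ N₂' x₃ N₃' x₄ N₄' t = some K → Eval K n' r' v →
      Eval (.trec M N₀ N₁ N₂ N₃ N₄) (n + n₀ + n₁ + n₂ + n₃ + n₄ + n')
        (r + r₀ + r₁ + r₂ + r₃ + r₄ + r') v

/-! ## Auxiliary `λ^A` programs

In the programs below a closed program may occur inside another one; this stands for a copy of it.
-/

/-- `promote : ℕ ⊸ !^∞_0 ℕ`; numbers are freely duplicable. -/
def promote : Tm :=
  .lam 0 (.nrec (.var 0)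
    (.lam 1 (.save ⊤ (Credit.ofNat 0) .zero))
    (savedFun 1 (.letPair 1 2 3 (.var 1)
      (.transfer 1 ⊤ (Credit.ofNat 0) 4 (.app (.var 3) .unit)
        (.save ⊤ (Credit.ofNat 0) (.succ (.var 4)))))))

/-- `addNat : ℕ ⊗ ℕ ⊸ ℕ`, addition. -/
def addNat : Tm :=
  .lam 0 (.letPair 1 1 2 (.var 0)
    (.nrec (.var 1) (.lam 3 (.var 2))
      (savedFun 3 (.letPair 1 4 5 (.var 3) (.succ (.app (.var 5) .unit))))))

/-- `phiTm : ℕ ⊸ ℕ` computes `⌈lg (n + 1)⌉`.  The recursion on `n` maintains the pair `(s, w)`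
with `s = ⌈lg (n + 1)⌉` and `w = 2 ^ s - 1 - n`; passing from `n` to `n + 1` it replaces `(s, 0)`
by `(s + 1, n)` and `(s, w + 1)` by `(s, w)`. -/
def phiTm : Tm :=
  .lam 0 (.letPair 1 1 2
    (.nrec (.var 0) (.lam 1 (.pair .zero .zero))
      (savedFun 1 (.letPair 1 2 3 (.var 1) (.letPair 1 4 5 (.app (.var 3) .unit)
        (.app
          (.nrec (.var 5)
            (.lam 6 (.lam 7 (.letPair 1 8 9 (.var 7) (.pair (.succ (.var 8)) (.var 9)))))
            (savedFun 6 (.letPair 1 10 11 (.var 6)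
              (.lam 7 (.letPair 1 8 9 (.var 7) (.pair (.var 8) (.var 10)))))))
          (.pair (.var 4) (.var 2)))))))
    (.var 1))

/-- `spawn : ℕ ⊸ ∃ α. !^1_α 1`; the credit packed in the result of `spawn n` is `n`. -/
def spawn : Tm :=
  .lam 0 (.nrec (.var 0)
    (.lam 1 (.pack (Credit.ofNat 0) (.save 1 (Credit.ofNat 0) .unit)))
    (savedFun 1 (.letPair 1 2 3 (.var 1)
      (.unpack 4 (.app (.var 3) .unit)
        (.transfer 1 1 (Credit.cvar 0) 5 (.var 4)
          (.create (Credit.ofNat 1)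
            (.pack ((Credit.cvar 0).plus (Credit.ofNat 1))
              (.save 1 ((Credit.cvar 0).plus (Credit.ofNat 1)) (.var 5)))))))))

/-- `sizeTm : tree A ⊸ ℕ ⊗ tree A` projects out the cached size and rebuilds the tree. -/
def sizeTm : Tm :=
  .lam 0 (.trec (.var 0)
    (.lam 1 (.pair .zero .emp))
    (savedFun 1 (.letPair 1 2 3 (.var 1)
      (.transfer 1 ⊤ (Credit.ofNat 0) 4 (.app promote (.var 3))
        (.pair (.var 4) (.node (.var 2) (.var 4) .emp .emp)))))
    (savedFun 1 (.letPair 1 2 3 (.var 1) (.letPair 1 4 5 (.var 2) (.letPair 1 6 7 (.var 3)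
      (.letPair 1 8 9 (.var 6) (.letPair 1 10 11 (.var 7)
        (.transfer 1 ⊤ (Credit.ofNat 0) 12 (.app promote (.var 5))
          (.pair (.var 12) (.node (.var 4) (.var 12)
            (.node (.var 8) (.var 9) (.fst (.var 10)) (.fst (.var 11))) .emp)))))))))
    (savedFun 1 (.letPair 1 2 3 (.var 1) (.letPair 1 4 5 (.var 2) (.letPair 1 6 7 (.var 3)
      (.letPair 1 8 9 (.var 6) (.letPair 1 10 11 (.var 7)
        (.transfer 1 ⊤ (Credit.ofNat 0) 12 (.app promote (.var 5))
          (.pair (.var 12) (.node (.var 4) (.var 12) .emp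
            (.node (.var 8) (.var 9) (.fst (.var 10)) (.fst (.var 11))))))))))))
    (savedFun 1 (.letPair 1 2 3 (.var 1) (.letPair 1 4 5 (.var 2) (.letPair 1 13 14 (.var 3)
      (.letPair 1 6 7 (.var 13) (.letPair 1 8 9 (.var 6) (.letPair 1 10 11 (.var 7)
        (.letPair 1 15 16 (.var 14) (.letPair 1 17 18 (.var 15) (.letPair 1 19 20 (.var 16)
          (.transfer 1 ⊤ (Credit.ofNat 0) 12 (.app promote (.var 5))
            (.pair (.var 12) (.node (.var 4) (.var 12)
              (.node (.var 8) (.var 9) (.fst (.var 10)) (.fst (.var 11)))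
              (.node (.var 17) (.var 18) (.fst (.var 19)) (.fst (.var 20)))))))))))))))))

/-- `newNode : !^∞_0 A ⊗ (tree (∃ α. !^∞_α A) ⊗ tree (∃ α. !^∞_α A)) ⊸ tree (∃ α. !^∞_α A)`
maps `(x, (l, r))` to the node with key `x` and subtrees `l`, `r`: it computes the size of the new
node from the sizes of `l` and `r`, spawns `φ` of that size many credits, and stores them. -/
def newNode : Tm :=
  .lam 0 (.letPair 1 1 2 (.var 0) (.letPair 1 3 4 (.var 2)
    (.transfer 1 ⊤ (Credit.ofNat 0) 5 (.var 1)
      (.letPair 1 6 7 (.app sizeTm (.var 3)) (.letPair 1 8 9 (.app sizeTm (.var 4))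
        (.transfer 1 ⊤ (Credit.ofNat 0) 10
          (.app promote (.succ (.app addNat (.pair (.var 6) (.var 8)))))
          (.unpack 11 (.app spawn (.app phiTm (.var 10)))
            (.transfer 1 1 (Credit.cvar 0) 12 (.var 11)
              (.node (.pack (Credit.cvar 0) (.save ⊤ (Credit.cvar 0) (.var 5))) (.var 10)
                (.var 7) (.var 9))))))))))

/-! ## The function `split` -/

/-- `newNode (x, (l, r))` for a variable `x` holding a key. -/
def mk (x : ℕ) (l r : Tm) : Tm :=
  .app newNode (.pair (.save ⊤ (Credit.ofNat 0) (.var x)) (.pair l r))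

/-- `openKey e x N`: unpack the element `e`, binding its credits as the innermost credit variable
`α`, its key as `x`, and releasing the `α` credits to the bank of `N`.  The auxiliary name `50` is
used for the packed value. -/
def openKey (e : Tm) (x : ℕ) (N : Tm) : Tm :=
  .unpack 50 e (.transfer 1 ⊤ (Credit.cvar 0) x (.var 50) N)

/-- `if p ≤ x then N₁ else N₂`, where the pivot is the variable `0`. -/
def ifLe (cmp : Tm) (x : ℕ) (N₁ N₂ : Tm) : Tm :=
  .caseOf 1 (.app cmp (.pair (.var 0) (.var x))) 51 N₁ 51 N₂

/-- The unchanged root, whose key `1` and credits (innermost credit variable) have just been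
released and whose cached size is the variable `3`, put back on top of the subtrees `l`, `r`. -/
def sameRoot (l r : Tm) : Tm :=
  .node (.pack (Credit.cvar 0) (.save ⊤ (Credit.cvar 0) (.var 1))) (.var 3) l r

/-- The pivot is at most the root key `x` (variable `1`), and the left child of the root is a node
with element `y` (variable `10`) and subtrees `a₁₁`, `a₁₂` (variables `12`, `13`); `right` is the
right subtree.  The credits of the two nodes that are taken apart are spent, and the recursive
result `(small, big)` is bound to the variables `30`, `31`. -/
def goLeft (cmp right : Tm) : Tm :=
  openKey (.var 10) 14
    (.spend (Credit.cvar 1) (.spend (Credit.cvar 0)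
      (ifLe cmp 14
        (.letPair 1 30 31 (.snd (.var 12))
          (.pair (.var 30) (mk 14 (.var 31) (mk 1 (.fst (.var 13)) right))))
        (.letPair 1 30 31 (.snd (.var 13))
          (.pair (mk 14 (.fst (.var 12)) (.var 30)) (mk 1 (.var 31) right))))))

/-- The mirror image of `goLeft`: the pivot is greater than the root key `x` (variable `1`), and
the right child of the root is a node with element `z` (variable `20`) and subtrees `a₂₁`, `a₂₂`
(variables `22`, `23`); `left` is the left subtree. -/
def goRight (cmp left : Tm) : Tm :=
  openKey (.var 20) 24
    (.spend (Credit.cvar 1) (.spend (Credit.cvar 0)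
      (ifLe cmp 24
        (.letPair 1 30 31 (.snd (.var 22))
          (.pair (mk 1 left (.var 30)) (mk 24 (.var 31) (.fst (.var 23)))))
        (.letPair 1 30 31 (.snd (.var 23))
          (.pair (mk 24 (mk 1 left (.fst (.var 22))) (.var 30)) (.var 31))))))

/-- Bind the element and cached size of the root to the variables `2`, `3`, given as the pair
`q`. -/
def bindRoot (q : ℕ) (N : Tm) : Tm := .letPair 1 2 3 (.var q) N

/-- Bind the data of a left child, given as the variable `q`, to the variables `10` (element),
`11` (cached size), `12`, `13` (subtrees with suspended recursive calls). -/
def bindLeft (q : ℕ) (N : Tm) : Tm :=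
  .letPair 1 40 41 (.var q) (.letPair 1 10 11 (.var 40) (.letPair 1 12 13 (.var 41) N))

/-- Bind the data of a right child, given as the variable `q`, to the variables `20` (element),
`21` (cached size), `22`, `23` (subtrees with suspended recursive calls). -/
def bindRight (q : ℕ) (N : Tm) : Tm :=
  .letPair 1 42 43 (.var q) (.letPair 1 20 21 (.var 42) (.letPair 1 22 23 (.var 43) N))

/-- The left child, unchanged. -/
def leftChild : Tm := .node (.var 10) (.var 11) (.fst (.var 12)) (.fst (.var 13))

/-- The right child, unchanged. -/
def rightChild : Tm := .node (.var 20) (.var 21) (.fst (.var 22)) (.fst (.var 23))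

/-- `split : !^∞_0 A ⊗ tree (∃ α. !^∞_α A) ⊸ tree (∃ α. !^∞_α A) ⊗ tree (∃ α. !^∞_α A)`, relative
to the comparison function `cmp` on `A`, splits a tree into the elements smaller than the pivot and
the elements greater than or equal to it.  Every call performs one `tick`. -/
def split (cmp : Tm) : Tm :=
  .lam 60 (.letPair 1 61 62 (.var 60) (.transfer 1 ⊤ (Credit.ofNat 0) 0 (.var 61)
    (.trec (.var 62)
      (.lam 60 (.tick (.pair .emp .emp)))
      (savedFun 60 (.tick (bindRoot 60
        (openKey (.var 2) 1 (ifLe cmp 1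
          (.pair .emp (sameRoot .emp .emp))
          (.pair (sameRoot .emp .emp) .emp))))))
      (savedFun 60 (.tick (.letPair 1 61 62 (.var 60) (bindRoot 61 (bindLeft 62
        (openKey (.var 2) 1 (ifLe cmp 1
          (goLeft cmp .emp)
          (.pair (sameRoot leftChild .emp) .emp))))))))
      (savedFun 60 (.tick (.letPair 1 61 62 (.var 60) (bindRoot 61 (bindRight 62
        (openKey (.var 2) 1 (ifLe cmp 1
          (.pair .emp (sameRoot .emp rightChild))
          (goRight cmp .emp))))))))
      (savedFun 60 (.tick (.letPair 1 61 62 (.var 60) (bindRoot 61 (.letPair 1 63 64 (.var 62)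
        (bindLeft 63 (bindRight 64
          (openKey (.var 2) 1 (ifLe cmp 1
            (goLeft cmp rightChild)
            (goRight cmp leftChild)))))))))))))

/-! ## Ordered key types and splay trees -/

/-- `u ≤ v` according to `cmp`: the call `cmp (u, v)` returns `inl ()` ("true"). -/
def KeyLe (cmp u v : Tm) : Prop :=
  ∃ (n : ℕ) (r : EReal), Eval (.app cmp (.pair u v)) n r (.inl .unit)

/-- `cmp : A ⊗ A ⊸ 1 ⊕ 1` is a closed value, using no external credits, that decides a total
preorder on the closed values of type `A` (`inl ()` is "true", `inr ()` is "false"). -/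
structure IsComparison (A : Ty) (cmp : Tm) : Prop where
  isValue : cmp.IsValue
  hasType : HasType 0 Ctx.empty (Res.bank 0) cmp (.lolli (.tensor A A) (.plus .one .one))
  decides : ∀ u v, IsClosedValue A u → IsClosedValue A v → ¬ KeyLe cmp u v →
    ∃ (n : ℕ) (r : EReal), Eval (.app cmp (.pair u v)) n r (.inr .unit)
  total : ∀ u v, IsClosedValue A u → IsClosedValue A v → KeyLe cmp u v ∨ KeyLe cmp v u
  trans : ∀ u v w, IsClosedValue A u → IsClosedValue A v → IsClosedValue A w →
    KeyLe cmp u v → KeyLe cmp v w → KeyLe cmp u w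

/-- The order required of the keys in symmetric order: `u < v` if keys have to be distinct, and
`u ≤ v` if equal keys are allowed. -/
def KeyBefore (distinct : Bool) (cmp u v : Tm) : Prop :=
  match distinct with
  | true => ¬ KeyLe cmp v u
  | false => KeyLe cmp u v

/-- The key of an element `pack ℓ (save^∞_ℓ v)` is `v`. -/
def elemKey : Tm → Tm
  | .pack _ (.save _ _ v) => v
  | e => e

/-- The credits stored with an element `pack ℓ (save^∞_ℓ v)` are `ℓ`. -/
def elemCredit : Tm → Option Credit
  | .pack c (.save _ _ _) => some c
  | _ => none

/-- The keys of a tree value, in symmetric order. -/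
def treeKeys : Tm → List Tm
  | .node e _ l r => treeKeys l ++ elemKey e :: treeKeys r
  | _ => []

/-- The number of nodes of a tree value. -/
def treeSize : Tm → ℕ
  | .node _ _ l r => treeSize l + treeSize r + 1
  | _ => 0

/-- The binary search tree property with respect to the relation `R` on keys. -/
def IsSearchTree (R : Tm → Tm → Prop) : Tm → Prop
  | .node e _ l r => IsSearchTree R l ∧ IsSearchTree R r ∧
      (∀ u ∈ treeKeys l, R u (elemKey e)) ∧ (∀ u ∈ treeKeys r, R (elemKey e) u)
  | _ => True

/-- `φ(n) = ⌈lg (n + 1)⌉`. -/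
noncomputable def phi (n : ℕ) : ℕ := ⌈Real.logb 2 ((n : ℝ) + 1)⌉₊

/-- The credit invariant: every node caches the size `n` of the subtree rooted at it, and stores
exactly `φ(n)` credits. -/
def CreditInvariant : Tm → Prop
  | .node e m l r => CreditInvariant l ∧ CreditInvariant r ∧
      m = Tm.num (treeSize l + treeSize r + 1) ∧
      elemCredit e = some (Credit.ofNat (phi (treeSize l + treeSize r + 1)))
  | _ => True

/-- The type `tree (∃ α. !^∞_α A)`, for a closed type `A`. -/
def splayTy (A : Ty) : Ty := .tree (.ex (.bang ⊤ (Credit.cvar 0) A.shift))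

/-- `t` is a splay tree: a closed value of type `tree (∃ α. !^∞_α A)` that is a binary search tree
and satisfies the credit invariant. -/
structure IsSplayTree (distinct : Bool) (A : Ty) (cmp t : Tm) : Prop where
  closedValue : IsClosedValue (splayTy A) t
  searchTree : IsSearchTree (KeyBefore distinct cmp) t
  credits : CreditInvariant t

end LambdaA

namespace LambdaA

open Tm

/-! ## Scoping and closed terms -/

/-! A splay tree carries no more information than its shape and its keys: the credit invariant
forces every cached size and every stored credit. So a tree value of the right type with the
invariant is `enc T` for some binary tree `T` of closed values of type `A` (`exists_eq_enc`), and
`enc T` is a splay tree exactly when the keys of `T`, read in symmetric order, are pairwise ordered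
(`isSplayTree_enc`).

It therefore suffices to know that `split` sends `enc T` to a pair `(enc a, enc b)` with `inorder a
++ inorder b = inorder T` (`run_split`): both factors of an ordered list are ordered. Every branch
of `split` only regroups subtrees without disturbing the symmetric order, whatever the comparisons
answer, so `run_split` needs no property of the order. The preorder laws enter only in
`keyBefore_trans`. Results of `newNode` are again of the form `enc` because it recomputes the size
and the credits from its subtrees (`run_newNode`).

The programs are run symbolically: costs are dropped from the judgment, each evaluation rule becomes
an equivalence usable for rewriting, closed terms are fixed by substitution, and suspended recursive
calls are abstracted to unknown closed terms (`ev_nrec_num`, `trec_enc_cases`). No type soundness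
theorem is involved: the results are typed directly, from their form `enc a`. -/

/-- The free term variables of `M` lie in `S` and its free credit variables are below `d`. -/
def Scoped : ℕ → Set ℕ → Tm → Prop
  | _, S, .var y => y ∈ S
  | d, S, .lam y M => Scoped d (insert y S) M
  | d, S, .app M N => Scoped d S M ∧ Scoped d S N
  | _, _, .unit => True
  | d, S, .pair M N => Scoped d S M ∧ Scoped d S N
  | d, S, .letPair _ y z M N => Scoped d S M ∧ Scoped d (insert z (insert y S)) N
  | d, S, .inl M => Scoped d S M
  | d, S, .inr M => Scoped d S M
  | d, S, .caseOf _ M y N₁ z N₂ =>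
      Scoped d S M ∧ Scoped d (insert y S) N₁ ∧ Scoped d (insert z S) N₂
  | d, S, .lazyPair M N => Scoped d S M ∧ Scoped d S N
  | d, S, .fst M => Scoped d S M
  | d, S, .snd M => Scoped d S M
  | _, _, .zero => True
  | d, S, .succ M => Scoped d S M
  | d, S, .nrec M N₁ N₂ => Scoped d S M ∧ Scoped d S N₁ ∧ Scoped d S N₂
  | _, _, .nil => True
  | d, S, .cons M N => Scoped d S M ∧ Scoped d S N
  | d, S, .lrec M N₁ N₂ => Scoped d S M ∧ Scoped d S N₁ ∧ Scoped d S N₂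
  | d, S, .tick M => Scoped d S M
  | d, S, .create c M => c.WF d ∧ Scoped d S M
  | d, S, .spend c M => c.WF d ∧ Scoped d S M
  | d, S, .save _ c M => c.WF d ∧ Scoped d S M
  | d, S, .transfer _ _ c y M N => c.WF d ∧ Scoped d S M ∧ Scoped d (insert y S) N
  | d, S, .pack c M => c.WF d ∧ Scoped d S M
  | d, S, .unpack y M N => Scoped d S M ∧ Scoped (d + 1) (insert y S) N
  | _, _, .emp => True
  | d, S, .node M N L R => Scoped d S M ∧ Scoped d S N ∧ Scoped d S L ∧ Scoped d S R
  | d, S, .trec M N₀ N₁ N₂ N₃ N₄ => Scoped d S M ∧ Scoped d S N₀ ∧ Scoped d S N₁ ∧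
      Scoped d S N₂ ∧ Scoped d S N₃ ∧ Scoped d S N₄

/-- Closed terms. -/
def Closed (M : Tm) : Prop := Scoped 0 ∅ M

theorem Credit.WF.mono {d d' : ℕ} (h : d ≤ d') {c : Credit} (hc : c.WF d) : c.WF d' :=
  fun i hi => (hc i hi).trans_le h

theorem Scoped.mono {M : Tm} {d d' : ℕ} {S S' : Set ℕ} (hd : d ≤ d') (hS : S ⊆ S')
    (h : Scoped d S M) : Scoped d' S' M := by
  have hi : ∀ {S S' : Set ℕ} (y : ℕ), S ⊆ S' → insert y S ⊆ insert y S' :=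
    fun y h => Set.insert_subset_insert h
  induction M generalizing d d' S S'
  case unpack y M N ihM ihN =>
    exact ⟨ihM hd hS h.1, ihN (Nat.succ_le_succ hd) (hi _ hS) h.2⟩
  all_goals
    simp only [Scoped] at h ⊢ <;> grind [Credit.WF.mono]

theorem Scoped.subst_eq {M : Tm} {d : ℕ} {S : Set ℕ} (h : Scoped d S M) {x : ℕ} (hx : x ∉ S)
    (v : Tm) : M.subst x v = M := by
  induction M generalizing d S <;> simp only [Scoped] at h <;> simp only [Tm.subst] <;>
    grind

theorem Credit.subst_of_WF {d : ℕ} {c : Credit} (h : c.WF d) {σ : ℕ → Credit}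
    (hσ : ∀ i < d, σ i = Credit.cvar i) : c.subst σ = c := by
  have h1 : c.vars.bind (fun i => (σ i).vars) = c.vars.bind (fun i => {i}) :=
    Multiset.bind_congr fun i hi => by rw [hσ i (h i hi)]; rfl
  have h2 : c.vars.map (fun i => (σ i).const) = c.vars.map (fun _ => 0) :=
    Multiset.map_congr rfl fun i hi => by rw [hσ i (h i hi)]; rfl
  ext1
  · simpa [Credit.subst, h1] using Multiset.bind_singleton c.vars id
  · simp [Credit.subst, h2]

@[simp] theorem Credit.cvar_subst (i : ℕ) (σ : ℕ → Credit) : (Credit.cvar i).subst σ = σ i := by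
  ext1 <;> simp [Credit.subst, Credit.cvar]

@[simp] theorem Credit.ofNat_subst (n : ℕ) (σ : ℕ → Credit) :
    (Credit.ofNat n).subst σ = Credit.ofNat n := by
  ext1 <;> simp [Credit.subst, Credit.ofNat]

@[simp] theorem Credit.plus_subst (c c' : Credit) (σ : ℕ → Credit) :
    (c.plus c').subst σ = (c.subst σ).plus (c'.subst σ) := by
  ext1 <;> simp [Credit.subst, Credit.plus]; omega

@[simp] theorem Credit.ofNat_plus (m n : ℕ) :
    (Credit.ofNat m).plus (Credit.ofNat n) = Credit.ofNat (m + n) := by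
  ext1 <;> simp [Credit.plus, Credit.ofNat]

@[simp] theorem Credit.ofNat_shift (n : ℕ) : (Credit.ofNat n).shift = Credit.ofNat n :=
  Credit.ofNat_subst _ _

@[simp] theorem Credit.cvar_shift (i : ℕ) : (Credit.cvar i).shift = Credit.cvar (i + 1) :=
  Credit.cvar_subst _ _

@[simp] theorem Credit.up_zero (σ : ℕ → Credit) : Credit.up σ 0 = Credit.cvar 0 := rfl

@[simp] theorem Credit.up_one (σ : ℕ → Credit) : Credit.up σ 1 = (σ 0).shift := rfl

@[simp] theorem Credit.up_succ (σ : ℕ → Credit) (i : ℕ) :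
    Credit.up σ (i + 1) = (σ i).shift := rfl

@[simp] theorem Credit.inst_zero (c : Credit) : Credit.inst c 0 = c := rfl

@[simp] theorem Credit.WF_cvar (i d : ℕ) : (Credit.cvar i).WF d ↔ i < d := by
  simp [Credit.WF, Credit.cvar]

@[simp] theorem Credit.WF_ofNat (n d : ℕ) : (Credit.ofNat n).WF d := by
  simp [Credit.WF, Credit.ofNat]

@[simp] theorem Credit.WF_plus (c c' : Credit) (d : ℕ) :
    (c.plus c').WF d ↔ c.WF d ∧ c'.WF d := by
  simp [Credit.WF, Credit.plus, or_imp, forall_and]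

@[simp] theorem Credit.ofNat_inj {m n : ℕ} : Credit.ofNat m = Credit.ofNat n ↔ m = n := by
  simp [Credit.ofNat]

theorem Credit.up_eq_cvar {d : ℕ} {σ : ℕ → Credit} (hσ : ∀ i < d, σ i = Credit.cvar i) :
    ∀ i < d + 1, Credit.up σ i = Credit.cvar i
  | 0, _ => rfl
  | i + 1, h => by simp [hσ i (by omega)]

/-- Allowing every `σ` that fixes the variables below `d`, rather than only closed terms, keeps the
induction going under `unpack`, where `Credit.up σ` fixes one variable more. -/
theorem Scoped.csubst_eq {M : Tm} {d : ℕ} {S : Set ℕ} (h : Scoped d S M) {σ : ℕ → Credit}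
    (hσ : ∀ i < d, σ i = Credit.cvar i) : M.csubst σ = M := by
  induction M generalizing d S σ <;> simp only [Scoped] at h <;> simp only [Tm.csubst] <;>
    grind [Credit.subst_of_WF, Credit.up_eq_cvar]

theorem Ty.subst_of_WF {A : Ty} {d : ℕ} (h : A.WF d) {σ : ℕ → Credit}
    (hσ : ∀ i < d, σ i = Credit.cvar i) : A.subst σ = A := by
  induction A generalizing d σ <;> simp only [Ty.WF] at h <;> simp only [Ty.subst] <;>
    grind [Credit.subst_of_WF, Credit.up_eq_cvar]

/-- Bounding the domain of `Γ` by an arbitrary set `S` lets the induction extend `S` at each binder.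
The purpose is the closedness of values typed in the empty context. -/
theorem HasType.scoped {d : ℕ} {Γ : Ctx} {f : Res} {M : Tm} {A : Ty} (h : HasType d Γ f M A)
    {S : Set ℕ} (hS : ∀ x, Γ x ≠ none → x ∈ S) : Scoped d S M := by
  have hb : ∀ {Γ : Ctx} {S : Set ℕ} (x : ℕ) (A : Ty), (∀ y, Γ y ≠ none → y ∈ S) →
      ∀ y, (Γ.bind x A) y ≠ none → y ∈ insert x S := by
    intro Γ S x A h y hy
    by_cases hyx : y = x
    · exact Or.inl hyx
    · exact Or.inr (h y (by simpa [Ctx.bind, Function.update_of_ne hyx] using hy))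
  have hs : ∀ {Γ : Ctx} {S : Set ℕ}, (∀ y, Γ y ≠ none → y ∈ S) →
      ∀ y, Γ.shift y ≠ none → y ∈ S := by
    intro Γ S h y hy
    exact h y (by simpa [Ctx.shift] using hy)
  induction h generalizing S
  case var h _ => exact hS _ (by simp [h])
  case letPair ih₁ ih₂ => exact ⟨ih₁ hS, ih₂ (hb _ _ (hb _ _ hS))⟩
  case unpack ih₁ ih₂ => exact ⟨ih₁ hS, ih₂ (hb _ _ (hs hS))⟩
  all_goals
    simp only [Scoped] <;> grind

theorem HasType.closed {f : Res} {M : Tm} {A : Ty} (h : HasType 0 Ctx.empty f M A) : Closed M := by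
  exact h.scoped fun x hx => (hx rfl).elim

/-! ## Evaluation up to cost -/

/-- `M ↓ v`. -/
def Ev (M v : Tm) : Prop := ∃ (n : ℕ) (r : EReal), Eval M n r v

/-- Application of the function value `F` to the value `u` yields `v`. -/
def Run (F u v : Tm) : Prop :=
  match F with
  | .lam x M => Ev (M.subst x u) v
  | _ => False

theorem run_lam {x : ℕ} {M u v : Tm} : Run (.lam x M) u v ↔ Ev (M.subst x u) v := Iff.rfl

/-! ### Evaluation rules as equivalences -/

section inversion

variable {M N M' N' L R v : Tm} {k k' : ℕ∞} {c : Credit} {x y : ℕ}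

theorem ev_lam : Ev (.lam x M) v ↔ v = .lam x M := by
  constructor
  · rintro ⟨n, r, h⟩; cases h; rfl
  · rintro rfl; exact ⟨_, _, .lam⟩

/-- Isolating the call as `Run F u v` lets the specification of a program such as `spawn` be applied
as a rewrite rule, without unfolding its body. -/
theorem ev_app : Ev (.app M N) v ↔ ∃ F, Ev M F ∧ ∃ u, Ev N u ∧ Run F u v := by
  constructor
  · rintro ⟨n, r, h⟩; cases h with | app h₁ h₂ h₃ => exact ⟨_, ⟨_, _, h₁⟩, _, ⟨_, _, h₂⟩, _, _, h₃⟩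
  · rintro ⟨F, ⟨_, _, h₁⟩, _, ⟨_, _, h₂⟩, h₃⟩
    cases F with
    | lam => obtain ⟨_, _, h₃⟩ := h₃; exact ⟨_, _, .app h₁ h₂ h₃⟩
    | _ => exact h₃.elim

theorem ev_unit : Ev .unit v ↔ v = .unit := by
  constructor
  · rintro ⟨n, r, h⟩; cases h; rfl
  · rintro rfl; exact ⟨_, _, .unit⟩

theorem ev_pair : Ev (.pair M N) v ↔ ∃ u, Ev M u ∧ ∃ w, Ev N w ∧ v = .pair u w := by
  constructor
  · rintro ⟨n, r, h⟩; cases h with | pair h₁ h₂ => exact ⟨_, ⟨_, _, h₁⟩, _, ⟨_, _, h₂⟩, rfl⟩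
  · rintro ⟨_, ⟨_, _, h₁⟩, _, ⟨_, _, h₂⟩, rfl⟩; exact ⟨_, _, .pair h₁ h₂⟩

theorem ev_letPair : Ev (.letPair k' x y M N) v ↔
    ∃ u w, Ev M (.pair u w) ∧ Ev ((N.subst y w).subst x u) v := by
  constructor
  · rintro ⟨n, r, h⟩; cases h with | letPair h₁ h₂ => exact ⟨_, _, ⟨_, _, h₁⟩, _, _, h₂⟩
  · rintro ⟨_, _, ⟨_, _, h₁⟩, _, _, h₂⟩; exact ⟨_, _, .letPair h₁ h₂⟩

theorem ev_inl : Ev (.inl M) v ↔ ∃ u, Ev M u ∧ v = .inl u := by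
  constructor
  · rintro ⟨n, r, h⟩; cases h with | inl h => exact ⟨_, ⟨_, _, h⟩, rfl⟩
  · rintro ⟨_, ⟨_, _, h⟩, rfl⟩; exact ⟨_, _, .inl h⟩

theorem ev_inr : Ev (.inr M) v ↔ ∃ u, Ev M u ∧ v = .inr u := by
  constructor
  · rintro ⟨n, r, h⟩; cases h with | inr h => exact ⟨_, ⟨_, _, h⟩, rfl⟩
  · rintro ⟨_, ⟨_, _, h⟩, rfl⟩; exact ⟨_, _, .inr h⟩

theorem ev_caseOf : Ev (.caseOf k' M x N y N') v ↔
    (∃ u, Ev M (.inl u) ∧ Ev (N.subst x u) v) ∨ (∃ u, Ev M (.inr u) ∧ Ev (N'.subst y u) v) := by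
  constructor
  · rintro ⟨n, r, h⟩
    cases h with
    | case_inl h₁ h₂ => exact .inl ⟨_, ⟨_, _, h₁⟩, _, _, h₂⟩
    | case_inr h₁ h₂ => exact .inr ⟨_, ⟨_, _, h₁⟩, _, _, h₂⟩
  · rintro (⟨_, ⟨_, _, h₁⟩, _, _, h₂⟩ | ⟨_, ⟨_, _, h₁⟩, _, _, h₂⟩)
    · exact ⟨_, _, .case_inl h₁ h₂⟩
    · exact ⟨_, _, .case_inr h₁ h₂⟩

theorem ev_lazyPair : Ev (.lazyPair M N) v ↔ v = .lazyPair M N := by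
  constructor
  · rintro ⟨n, r, h⟩; cases h; rfl
  · rintro rfl; exact ⟨_, _, .lazyPair⟩

theorem ev_fst : Ev (.fst M) v ↔ ∃ M₁ M₂, Ev M (.lazyPair M₁ M₂) ∧ Ev M₁ v := by
  constructor
  · rintro ⟨n, r, h⟩; cases h with | fst h₁ h₂ => exact ⟨_, _, ⟨_, _, h₁⟩, _, _, h₂⟩
  · rintro ⟨_, _, ⟨_, _, h₁⟩, _, _, h₂⟩; exact ⟨_, _, .fst h₁ h₂⟩

theorem ev_snd : Ev (.snd M) v ↔ ∃ M₁ M₂, Ev M (.lazyPair M₁ M₂) ∧ Ev M₂ v := by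
  constructor
  · rintro ⟨n, r, h⟩; cases h with | snd h₁ h₂ => exact ⟨_, _, ⟨_, _, h₁⟩, _, _, h₂⟩
  · rintro ⟨_, _, ⟨_, _, h₁⟩, _, _, h₂⟩; exact ⟨_, _, .snd h₁ h₂⟩

theorem ev_zero : Ev .zero v ↔ v = .zero := by
  constructor
  · rintro ⟨n, r, h⟩; cases h; rfl
  · rintro rfl; exact ⟨_, _, .zero⟩

theorem ev_succ : Ev (.succ M) v ↔ ∃ u, Ev M u ∧ v = .succ u := by
  constructor
  · rintro ⟨n, r, h⟩; cases h with | succ h => exact ⟨_, ⟨_, _, h⟩, rfl⟩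
  · rintro ⟨_, ⟨_, _, h⟩, rfl⟩; exact ⟨_, _, .succ h⟩

theorem ev_nil : Ev .nil v ↔ v = .nil := by
  constructor
  · rintro ⟨n, r, h⟩; cases h; rfl
  · rintro rfl; exact ⟨_, _, .nil⟩

theorem ev_cons : Ev (.cons M N) v ↔ ∃ u, Ev M u ∧ ∃ w, Ev N w ∧ v = .cons u w := by
  constructor
  · rintro ⟨n, r, h⟩; cases h with | cons h₁ h₂ => exact ⟨_, ⟨_, _, h₁⟩, _, ⟨_, _, h₂⟩, rfl⟩
  · rintro ⟨_, ⟨_, _, h₁⟩, _, ⟨_, _, h₂⟩, rfl⟩; exact ⟨_, _, .cons h₁ h₂⟩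

theorem ev_tick : Ev (.tick M) v ↔ Ev M v := by
  constructor
  · rintro ⟨n, r, h⟩; cases h with | tick h => exact ⟨_, _, h⟩
  · rintro ⟨_, _, h⟩; exact ⟨_, _, .tick h⟩

theorem ev_create : Ev (.create c M) v ↔ (∃ l, c = .ofNat l) ∧ Ev M v := by
  constructor
  · rintro ⟨n, r, h⟩; cases h with | create h => exact ⟨⟨_, rfl⟩, _, _, h⟩
  · rintro ⟨⟨_, rfl⟩, _, _, h⟩; exact ⟨_, _, .create h⟩

theorem ev_spend : Ev (.spend c M) v ↔ (∃ l, c = .ofNat l) ∧ Ev M v := by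
  constructor
  · rintro ⟨n, r, h⟩; cases h with | spend h => exact ⟨⟨_, rfl⟩, _, _, h⟩
  · rintro ⟨⟨_, rfl⟩, _, _, h⟩; exact ⟨_, _, .spend h⟩

theorem ev_save : Ev (.save k c M) v ↔ (∃ l, c = .ofNat l) ∧ ∃ u, Ev M u ∧ v = .save k c u := by
  constructor
  · rintro ⟨n, r, h⟩; cases h with | save h => exact ⟨⟨_, rfl⟩, _, ⟨_, _, h⟩, rfl⟩
  · rintro ⟨⟨_, rfl⟩, _, ⟨_, _, h⟩, rfl⟩; exact ⟨_, _, .save h⟩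

theorem ev_transfer : Ev (.transfer k' k c x M N) v ↔
    (∃ l, c = .ofNat l) ∧ ∃ u, Ev M (.save k c u) ∧ Ev (N.subst x u) v := by
  constructor
  · rintro ⟨n, r, h⟩
    cases h with | transfer h₁ h₂ => exact ⟨⟨_, rfl⟩, _, ⟨_, _, h₁⟩, _, _, h₂⟩
  · rintro ⟨⟨_, rfl⟩, _, ⟨_, _, h₁⟩, _, _, h₂⟩; exact ⟨_, _, .transfer h₁ h₂⟩

theorem ev_pack : Ev (.pack c M) v ↔ (∃ l, c = .ofNat l) ∧ ∃ u, Ev M u ∧ v = .pack c u := by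
  constructor
  · rintro ⟨n, r, h⟩; cases h with | pack h => exact ⟨⟨_, rfl⟩, _, ⟨_, _, h⟩, rfl⟩
  · rintro ⟨⟨_, rfl⟩, _, ⟨_, _, h⟩, rfl⟩; exact ⟨_, _, .pack h⟩

theorem ev_unpack : Ev (.unpack x M N) v ↔ ∃ l u, Ev M (.pack (.ofNat l) u) ∧
    Ev ((N.csubst (Credit.inst (.ofNat l))).subst x u) v := by
  constructor
  · rintro ⟨n, r, h⟩
    cases h with | unpack h₁ h₂ => exact ⟨_, _, ⟨_, _, h₁⟩, _, _, h₂⟩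
  · rintro ⟨_, _, ⟨_, _, h₁⟩, _, _, h₂⟩; exact ⟨_, _, .unpack h₁ h₂⟩

theorem ev_emp : Ev .emp v ↔ v = .emp := by
  constructor
  · rintro ⟨n, r, h⟩; cases h; rfl
  · rintro rfl; exact ⟨_, _, .emp⟩

theorem ev_node : Ev (.node M N L R) v ↔
    ∃ e, Ev M e ∧ ∃ m, Ev N m ∧ ∃ l, Ev L l ∧ ∃ r, Ev R r ∧ v = .node e m l r := by
  constructor
  · rintro ⟨n, r, h⟩
    cases h with
    | node h₁ h₂ h₃ h₄ =>
      exact ⟨_, ⟨_, _, h₁⟩, _, ⟨_, _, h₂⟩, _, ⟨_, _, h₃⟩, _, ⟨_, _, h₄⟩, rfl⟩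
  · rintro ⟨_, ⟨_, _, h₁⟩, _, ⟨_, _, h₂⟩, _, ⟨_, _, h₃⟩, _, ⟨_, _, h₄⟩, rfl⟩
    exact ⟨_, _, .node h₁ h₂ h₃ h₄⟩

theorem ev_savedFun : Ev (savedFun x M) v ↔ v = savedFun x M := by
  simp [savedFun, ev_save, ev_lam]

theorem savedFun_inj : savedFun x M = savedFun y N ↔ x = y ∧ M = N := by
  simp [savedFun]

theorem ev_num {n : ℕ} : Ev (num n) v ↔ v = num n := by
  induction n generalizing v with
  | zero => exact ev_zero
  | succ n ih => simp [num, ev_succ, ih]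

theorem ev_nrec_zero :
    Ev (.nrec (num 0) (.lam x N) (savedFun y N')) v ↔ Ev (N.subst x .unit) v := by
  constructor
  · rintro ⟨n, r, h⟩
    cases h with
    | nrec_zero h₁ h₂ h₃ h₄ =>
      cases ev_lam.1 ⟨_, _, h₂⟩
      exact ⟨_, _, h₄⟩
    | nrec_succ h₁ h₂ h₃ h₄ => cases ev_num.1 ⟨_, _, h₁⟩
  · rintro ⟨_, _, h⟩
    obtain ⟨_, _, h₁⟩ := ev_num (n := 0) |>.2 rfl
    obtain ⟨_, _, h₂⟩ := ev_lam (x := x) (M := N) |>.2 rfl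
    obtain ⟨_, _, h₃⟩ := ev_savedFun (x := y) (M := N') |>.2 rfl
    exact ⟨_, _, .nrec_zero h₁ h₂ h₃ h⟩

theorem ev_nrec_succ {n : ℕ} :
    Ev (.nrec (num (n + 1)) (.lam x N) (savedFun y N')) v ↔
      Ev (N'.subst y (.pair (num n) (.lam 0 (.nrec (num n) (.lam x N) (savedFun y N'))))) v := by
  constructor
  · rintro ⟨n, r, h⟩
    cases h with
    | nrec_zero h₁ h₂ h₃ h₄ => cases ev_num.1 ⟨_, _, h₁⟩
    | nrec_succ h₁ h₂ h₃ h₄ =>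
      cases ev_num.1 ⟨_, _, h₁⟩
      cases ev_lam.1 ⟨_, _, h₂⟩
      obtain ⟨rfl, rfl⟩ := savedFun_inj.1 (ev_savedFun.1 ⟨_, _, h₃⟩)
      exact ⟨_, _, h₄⟩
  · rintro ⟨_, _, h⟩
    obtain ⟨_, _, h₁⟩ := ev_num (n := n + 1) |>.2 rfl
    obtain ⟨_, _, h₂⟩ := ev_lam (x := x) (M := N) |>.2 rfl
    obtain ⟨_, _, h₃⟩ := ev_savedFun (x := y) (M := N') |>.2 rfl
    exact ⟨_, _, .nrec_succ h₁ h₂ h₃ h⟩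

/-- With the branches already in value form, evaluating them returns them unchanged, so only the
scrutinee and the selected branch remain. -/
theorem ev_trec {N₀ N₁ N₂ N₃ N₄ : Tm} {x₀ x₁ x₂ x₃ x₄ : ℕ} :
    Ev (.trec M (.lam x₀ N₀) (savedFun x₁ N₁) (savedFun x₂ N₂) (savedFun x₃ N₃)
      (savedFun x₄ N₄)) v ↔
    ∃ t, Ev M t ∧ ∃ K, treeUnfold x₀ N₀ x₁ N₁ x₂ N₂ x₃ N₃ x₄ N₄ t = some K ∧ Ev K v := by
  constructor
  · rintro ⟨n, r, h⟩
    cases h with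
    | trec h h₀ h₁ h₂ h₃ h₄ hK h' =>
      cases ev_lam.1 ⟨_, _, h₀⟩
      obtain ⟨rfl, rfl⟩ := savedFun_inj.1 (ev_savedFun.1 ⟨_, _, h₁⟩)
      obtain ⟨rfl, rfl⟩ := savedFun_inj.1 (ev_savedFun.1 ⟨_, _, h₂⟩)
      obtain ⟨rfl, rfl⟩ := savedFun_inj.1 (ev_savedFun.1 ⟨_, _, h₃⟩)
      obtain ⟨rfl, rfl⟩ := savedFun_inj.1 (ev_savedFun.1 ⟨_, _, h₄⟩)
      exact ⟨_, ⟨_, _, h⟩, _, hK, _, _, h'⟩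
  · rintro ⟨t, ⟨_, _, h⟩, K, hK, _, _, h'⟩
    obtain ⟨_, _, h₀⟩ := ev_lam (x := x₀) (M := N₀) |>.2 rfl
    obtain ⟨_, _, h₁⟩ := ev_savedFun (x := x₁) (M := N₁) |>.2 rfl
    obtain ⟨_, _, h₂⟩ := ev_savedFun (x := x₂) (M := N₂) |>.2 rfl
    obtain ⟨_, _, h₃⟩ := ev_savedFun (x := x₃) (M := N₃) |>.2 rfl
    obtain ⟨_, _, h₄⟩ := ev_savedFun (x := x₄) (M := N₄) |>.2 rfl
    exact ⟨_, _, .trec h h₀ h₁ h₂ h₃ h₄ hK h'⟩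

end inversion

/-! ### Values, closed terms and recursion on numerals -/

theorem Tm.IsValue.ev {v w : Tm} (h : v.IsValue) : Ev v w ↔ w = v := by
  induction h generalizing w <;>
    simp_all [ev_lam, ev_unit, ev_pair, ev_lazyPair, ev_zero, ev_succ, ev_save, ev_pack, ev_emp,
      ev_node, ev_inl, ev_inr, ev_nil, ev_cons]

section values

variable {M M' N v : Tm} {k k' : ℕ∞} {c : Credit} {x y l : ℕ}

/-- Used in place of `ev_letPair` on tree data: the components are substituted at once, without
passing through existential quantifiers. -/
theorem ev_letPair_value (hM : M.IsValue) (hM' : M'.IsValue) :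
    Ev (.letPair k' x y (.pair M M') N) v ↔ Ev ((N.subst y M').subst x M) v := by
  simp [ev_letPair, ev_pair, hM.ev, hM'.ev]

theorem isValue_pair : (pair M N).IsValue ↔ M.IsValue ∧ N.IsValue :=
  ⟨fun h => by cases h with | pair h₁ h₂ => exact ⟨h₁, h₂⟩, fun h => .pair h.1 h.2⟩

theorem isValue_lazyPair : (lazyPair M N).IsValue ↔ True := ⟨fun _ => trivial, fun _ => .lazyPair _ _⟩

theorem isValue_save : (save k (.ofNat l) M).IsValue ↔ M.IsValue :=
  ⟨fun h => by cases h with | save _ _ h => exact h, fun h => .save _ _ h⟩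

theorem isValue_pack : (pack (.ofNat l) M).IsValue ↔ M.IsValue :=
  ⟨fun h => by cases h with | pack _ h => exact h, fun h => .pack _ h⟩

theorem isValue_num (n : ℕ) : (num n).IsValue := by
  induction n with
  | zero => exact .zero
  | succ n ih => exact .succ ih

end values

theorem Closed.subst_eq {M : Tm} (h : Closed M) (x : ℕ) (v : Tm) : M.subst x v = M :=
  Scoped.subst_eq h (Set.notMem_empty x) v

theorem Closed.csubst_eq {M : Tm} (h : Closed M) (σ : ℕ → Credit) : M.csubst σ = M :=
  Scoped.csubst_eq h fun _ hi => (Nat.not_lt_zero _ hi).elim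

theorem Closed.scoped {M : Tm} (h : Closed M) {d : ℕ} {S : Set ℕ} : Scoped d S M :=
  h.mono (Nat.zero_le _) (Set.empty_subset _)

@[simp] theorem closed_num (n : ℕ) : Closed (num n) := by
  induction n with
  | zero => trivial
  | succ n ih => exact ih

@[simp] theorem scoped_num (n d : ℕ) (S : Set ℕ) : Scoped d S (num n) := (closed_num n).scoped

theorem zero_eq_num : Tm.zero = num 0 := rfl

theorem succ_num (n : ℕ) : (num n).succ = num (n + 1) := rfl

@[simp] theorem savedFun_subst (y x : ℕ) (M v : Tm) :
    (savedFun y M).subst x v = savedFun y (if y = x then M else M.subst x v) := rfl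

@[simp] theorem scoped_savedFun {y d : ℕ} {S : Set ℕ} {M : Tm} :
    Scoped d S (savedFun y M) ↔ Scoped d (insert y S) M := by
  simp [savedFun, Scoped]

/-- The rule for recursion on natural numbers: the suspended recursive call `R` may be treated as
an unknown closed value. -/
theorem ev_nrec_num {x y : ℕ} {N N' : Tm} (f : ℕ → Tm)
    (hN : Scoped 0 {x} N) (hN' : Scoped 0 {y} N')
    (h0 : ∀ v, Ev (N.subst x .unit) v ↔ v = f 0)
    (hs : ∀ n R, Closed R → (∀ v, Ev R v ↔ v = R) → (∀ v, Run R .unit v ↔ v = f n) →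
      ∀ v, Ev (N'.subst y (.pair (num n) R)) v ↔ v = f (n + 1))
    (n : ℕ) (v : Tm) : Ev (.nrec (num n) (.lam x N) (savedFun y N')) v ↔ v = f n := by
  have hc : ∀ n, Closed (.nrec (num n) (.lam x N) (savedFun y N')) := fun n => by
    simp only [Closed, Scoped, scoped_savedFun]
    exact ⟨closed_num n, by simpa using hN, by simpa using hN'⟩
  induction n generalizing v with
  | zero => rw [ev_nrec_zero, h0]
  | succ n ih =>
    rw [ev_nrec_succ]
    -- The unknown `R` is the thunked recursive call. Its body is closed, so running the thunk
    -- substitutes nothing and the induction hypothesis applies.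
    refine hs n (.lam 0 _) ?_ (fun v => ev_lam) (fun v => ?_) v
    · simp only [Closed, Scoped]
      exact (hc n).scoped
    · rw [run_lam, (hc n).subst_eq]
      exact ih v

/-! ### Arithmetic of the function `phi` -/

theorem phi_eq_clog (n : ℕ) : phi n = Nat.clog 2 (n + 1) := by
  rw [phi, ← Real.natCeil_logb_natCast]
  push_cast
  rfl

theorem le_two_pow_phi (n : ℕ) : n + 1 ≤ 2 ^ phi n := by
  rw [phi_eq_clog]
  exact Nat.le_pow_clog one_lt_two _

/-- No slack means that `n + 1` equals `2 ^ phi n`, so `n + 2` no longer fits below this power,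
while it does fit below the next one. -/
theorem phi_succ_of_sub_eq_zero {n : ℕ} (h : 2 ^ phi n - (n + 1) = 0) :
    phi (n + 1) = phi n + 1 := by
  have h₁ := le_two_pow_phi n
  apply le_antisymm
  · rw [phi_eq_clog (n + 1)]
    exact Nat.clog_le_of_le_pow (by omega)
  · by_contra! h₂
    rw [phi_eq_clog (n + 1), Nat.lt_succ_iff, Nat.clog_le_iff_le_pow one_lt_two] at h₂
    omega

theorem phi_succ_of_sub_ne_zero {n : ℕ} (h : 2 ^ phi n - (n + 1) ≠ 0) : phi (n + 1) = phi n := by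
  apply le_antisymm
  · rw [phi_eq_clog (n + 1)]
    exact Nat.clog_le_of_le_pow (by omega)
  · rw [phi_eq_clog, phi_eq_clog]
    exact Nat.clog_mono_right 2 (Nat.le_succ _)

/-! ### Specifications of the numerical programs -/

section specifications

attribute [local simp] Tm.subst Tm.csubst run_lam ev_lam ev_app ev_unit ev_pair ev_letPair
  ev_lazyPair ev_fst ev_snd ev_succ ev_save ev_transfer ev_pack ev_unpack ev_create ev_emp
  ev_node ev_num ev_savedFun zero_eq_num succ_num Scoped Closed.subst_eq Closed.csubst_eq

@[simp] theorem ev_promote {v : Tm} : Ev promote v ↔ v = promote := ev_lam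

@[simp] theorem run_promote {n : ℕ} {v : Tm} :
    Run promote (num n) v ↔ v = .save ⊤ (Credit.ofNat 0) (num n) := by
  simp only [promote, run_lam]
  simp
  rw [ev_nrec_num fun n => .save ⊤ (Credit.ofNat 0) (num n)] <;> simp
  intro n R hR hR' h v
  simp [*]

@[simp] theorem ev_addNat {v : Tm} : Ev addNat v ↔ v = addNat := ev_lam

@[simp] theorem run_addNat {m n : ℕ} {v : Tm} :
    Run addNat (.pair (num m) (num n)) v ↔ v = num (m + n) := by
  simp only [addNat, run_lam]
  simp
  rw [ev_nrec_num fun m => num (m + n)] <;> simp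
  intro m R hR hR' h v
  simp [*]
  rw [Nat.add_right_comm]

@[simp] theorem ev_spawn {v : Tm} : Ev spawn v ↔ v = spawn := ev_lam

@[simp] theorem run_spawn {n : ℕ} {v : Tm} : Run spawn (num n) v ↔
    v = .pack (Credit.ofNat n) (.save 1 (Credit.ofNat n) .unit) := by
  simp only [spawn, run_lam]
  simp
  rw [ev_nrec_num fun n => .pack (Credit.ofNat n) (.save 1 (Credit.ofNat n) .unit)] <;> simp
  intro n R hR hR' h v
  simp [*]

@[simp] theorem ev_phiTm {v : Tm} : Ev phiTm v ↔ v = phiTm := ev_lam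

@[simp] theorem run_phiTm {n : ℕ} {v : Tm} : Run phiTm (num n) v ↔ v = num (phi n) := by
  simp only [phiTm, run_lam]
  simp
  -- The outer `letPair` has left the recursion under quantifiers, hence the congruences. The
  -- recursion computes `phi n` together with the slack `2 ^ phi n - (n + 1)` up to the next power
  -- of two.
  refine (exists_congr fun u => and_congr_left' (exists_congr fun x =>
    ev_nrec_num (fun n => .pair (num (phi n)) (num (2 ^ phi n - (n + 1)))) ?_ ?_ ?_ ?_ n _)).trans ?_
    <;> simp
  · simp [phi_eq_clog]
  · intro n R hR hR' h v
    simp [*]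
    rcases hw : 2 ^ phi n - (n + 1) with _ | w
    · simp [ev_nrec_zero]
      -- Here `2 ^ phi n = n + 1`, so the new slack is `2 * (n + 1) - (n + 2) = n`, which is
      -- precisely the predecessor that the recursor hands to the step function.
      rw [phi_succ_of_sub_eq_zero hw, show 2 ^ (phi n + 1) - (n + 1 + 1) = n by
        have := le_two_pow_phi n; omega]
    · simp [ev_nrec_succ]
      rw [phi_succ_of_sub_ne_zero (by omega), show 2 ^ phi n - (n + 1 + 1) = w by omega]

end specifications

/-! ### Encoding trees of keys as tree values -/

theorem IsClosedValue.closed {A : Ty} {v : Tm} (h : IsClosedValue A v) : Closed v :=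
  h.2.choose_spec.closed

/-- The closed values of type `A`. -/
abbrev Key (A : Ty) : Type := {v : Tm // IsClosedValue A v}

section keys

variable {A : Ty}

@[simp] theorem closed_key (k : Key A) : Closed k.1 := k.2.closed

@[simp] theorem scoped_key (k : Key A) (d : ℕ) (S : Set ℕ) : Scoped d S k.1 :=
  (closed_key k).scoped

@[simp] theorem ev_key (k : Key A) {v : Tm} : Ev k.1 v ↔ v = k.1 := k.2.1.ev

/-- The element with key `k` at the root of a tree with `n` nodes. -/
noncomputable def elem (k : Key A) (n : ℕ) : Tm :=
  .pack (.ofNat (phi n)) (.save ⊤ (.ofNat (phi n)) k.1)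

@[simp] theorem isValue_key (k : Key A) : k.1.IsValue := k.2.1

/-- The tree value with the given keys whose credits and cached sizes are as in the credit
invariant. -/
noncomputable def enc : BinaryTree (Key A) → Tm
  | .nil => .emp
  | .node k l r => .node (elem k (l.numNodes + r.numNodes + 1)) (num (l.numNodes + r.numNodes + 1))
      (enc l) (enc r)

@[simp] theorem closed_enc (t : BinaryTree (Key A)) : Closed (enc t) := by
  induction t with
  | nil => trivial
  | node k l r ihl ihr => simp [enc, elem, Closed, Scoped, ihl.scoped, ihr.scoped]

@[simp] theorem scoped_enc (t : BinaryTree (Key A)) (d : ℕ) (S : Set ℕ) : Scoped d S (enc t) :=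
  (closed_enc t).scoped

@[simp] theorem ev_enc (t : BinaryTree (Key A)) {v : Tm} : Ev (enc t) v ↔ v = enc t := by
  induction t generalizing v with
  | nil => exact ev_emp
  | node k l r ihl ihr => simp [enc, elem, ev_node, ev_pack, ev_save, ev_num, ihl, ihr]

@[simp] theorem isValue_enc (t : BinaryTree (Key A)) : (enc t).IsValue := by
  induction t with
  | nil => exact .emp
  | node k l r ihl ihr => exact .node (.pack _ (.save _ _ k.2.1)) (isValue_num _) ihl ihr

/-- The data supplied by the tree recursor for a child `node k l r`, for given suspended recursive
calls `R`. -/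
noncomputable def encChild (R : BinaryTree (Key A) → Tm) (k : Key A) (l r : BinaryTree (Key A)) :
    Tm :=
  .pair (.pair (elem k (l.numNodes + r.numNodes + 1)) (num (l.numNodes + r.numNodes + 1)))
    (.pair (.lazyPair (enc l) (R l)) (.lazyPair (enc r) (R r)))

/-- One unfolding of the tree recursor on the tree value `enc t`, for given branches and suspended
recursive calls `R`. -/
noncomputable def encUnfold (N₀ : Tm) (N₁ N₂ N₃ N₄ : Tm → Tm)
    (R : BinaryTree (Key A) → Tm) : BinaryTree (Key A) → Tm
  | .nil => N₀
  | .node k .nil .nil => N₁ (.pair (elem k 1) (num 1))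
  | .node k (.node k' l r) .nil =>
      N₂ (.pair (.pair (elem k (l.numNodes + r.numNodes + 1 + 1))
        (num (l.numNodes + r.numNodes + 1 + 1))) (encChild R k' l r))
  | .node k .nil (.node k' l r) =>
      N₃ (.pair (.pair (elem k (l.numNodes + r.numNodes + 1 + 1))
        (num (l.numNodes + r.numNodes + 1 + 1))) (encChild R k' l r))
  | .node k (.node k' l r) (.node k'' l' r') =>
      N₄ (.pair (.pair
          (elem k (l.numNodes + r.numNodes + 1 + (l'.numNodes + r'.numNodes + 1) + 1))
          (num (l.numNodes + r.numNodes + 1 + (l'.numNodes + r'.numNodes + 1) + 1)))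
        (.pair (encChild R k' l r) (encChild R k'' l' r')))

/-- The tree recursor on tree values: the suspended recursive calls may be treated as unknown
closed terms. -/
theorem trec_enc_cases (Q : Tm → Prop) {t : BinaryTree (Key A)} {N₀ N₁ N₂ N₃ N₄ : Tm}
    {x₀ x₁ x₂ x₃ x₄ : ℕ} (h₀ : Scoped 0 {x₀} N₀) (h₁ : Scoped 0 {x₁} N₁) (h₂ : Scoped 0 {x₂} N₂)
    (h₃ : Scoped 0 {x₃} N₃) (h₄ : Scoped 0 {x₄} N₄)
    (H : ∀ R : BinaryTree (Key A) → Tm, (∀ t, Closed (R t)) →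
      (∀ t v, Ev (R t) v ↔ Ev (encUnfold (N₀.subst x₀ .unit) (N₁.subst x₁) (N₂.subst x₂)
        (N₃.subst x₃) (N₄.subst x₄) R t) v) → Q (R t)) :
    Q (.trec (enc t) (.lam x₀ N₀) (savedFun x₁ N₁) (savedFun x₂ N₂) (savedFun x₃ N₃)
        (savedFun x₄ N₄)) := by
  -- Taking for `R` the recursor on the encoding makes the goal `Q (R t)` by definition; the
  -- unfolding equation is then the operational rule.
  refine H (fun t => .trec (enc t) (.lam x₀ N₀) (savedFun x₁ N₁) (savedFun x₂ N₂) (savedFun x₃ N₃)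
    (savedFun x₄ N₄)) (fun t => ?_) (fun t v => ?_)
  · simp only [Closed, Scoped, scoped_enc, scoped_savedFun, insert_empty_eq]
    exact ⟨trivial, h₀, h₁, h₂, h₃, h₄⟩
  · rw [ev_trec]
    simp only [ev_enc, exists_eq_left]
    rcases t with _ | ⟨k, _ | ⟨k', l, r⟩, _ | ⟨k'', l', r'⟩⟩ <;>
      simp [enc, treeUnfold, encUnfold, encChild, childData, BinaryTree.numNodes]

end keys

/-! ### Specifications of the tree programs -/

section specifications

variable {A : Ty}

attribute [local simp] Tm.subst Tm.csubst run_lam ev_lam ev_app ev_unit ev_pair ev_letPair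
  ev_lazyPair ev_fst ev_snd ev_succ ev_save ev_transfer ev_pack ev_unpack ev_create ev_emp
  ev_node ev_num ev_savedFun zero_eq_num succ_num Scoped Closed.subst_eq Closed.csubst_eq
  elem ev_letPair_value isValue_num isValue_pair
  isValue_lazyPair isValue_save isValue_pack

@[simp] theorem ev_sizeTm {v : Tm} : Ev sizeTm v ↔ v = sizeTm := ev_lam

@[simp] theorem closed_promote : Closed promote := by simp [Closed, promote]

@[simp] theorem run_sizeTm {t : BinaryTree (Key A)} {v : Tm} :
    Run sizeTm (enc t) v ↔ v = .pair (num t.numNodes) (enc t) := by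
  simp only [sizeTm, run_lam]
  simp [-ev_letPair]
  -- A single unfolding suffices: `sizeTm` takes only the first component of each lazy pair, so the
  -- suspended calls `R` never run and no induction is needed.
  refine trec_enc_cases (fun M => Ev M v ↔ _) ?_ ?_ ?_ ?_ ?_ fun R hR h => ?_
  case refine_6 =>
    rw [h]
    rcases t with _ | ⟨k, _ | ⟨k', l, r⟩, _ | ⟨k'', l', r'⟩⟩ <;>
      simp only [encUnfold, encChild] <;>
      simp [-ev_letPair, hR, enc, BinaryTree.numNodes]
  all_goals simp [closed_promote.scoped]

@[simp] theorem closed_sizeTm : Closed sizeTm := by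
  simp [Closed, sizeTm, closed_promote.scoped]

@[simp] theorem closed_newNode : Closed newNode := by
  simp [Closed, newNode, spawn, addNat, phiTm, closed_promote.scoped, closed_sizeTm.scoped]

@[simp] theorem ev_newNode {v : Tm} : Ev newNode v ↔ v = newNode := ev_lam

@[simp] theorem closed_spawn : Closed spawn := by
  simp [Closed, spawn]

@[simp] theorem closed_addNat : Closed addNat := by
  simp [Closed, addNat]

@[simp] theorem closed_phiTm : Closed phiTm := by
  simp [Closed, phiTm]

-- This is where the credit invariant is re-established: sizes read from the encoded subtrees give
-- the new size `m`, and `spawn` produces `phi m` credits, the amount that `enc` prescribes.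
@[simp] theorem run_newNode {k : Key A} {l r : BinaryTree (Key A)} {v : Tm} :
    Run newNode (.pair (.save ⊤ (Credit.ofNat 0) k.1) (.pair (enc l) (enc r))) v ↔
      v = enc (.node k l r) := by
  simp only [newNode, run_lam]
  simp [enc]
end specifications

/-- The keys of a tree in symmetric order. -/
def inorder {α : Type*} : BinaryTree α → List α
  | .nil => []
  | .node k l r => inorder l ++ k :: inorder r

/-! ### Evaluation of `split` -/

section split

variable {A : Ty}

attribute [local simp] Tm.subst Tm.csubst run_lam ev_lam ev_app ev_unit ev_pair
  ev_lazyPair ev_fst ev_snd ev_succ ev_save ev_transfer ev_pack ev_unpack ev_create ev_emp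
  ev_node ev_num ev_savedFun zero_eq_num succ_num Scoped Closed.subst_eq Closed.csubst_eq
  elem ev_letPair_value isValue_num isValue_pair
  isValue_lazyPair isValue_save isValue_pack ev_tick ev_spend ev_caseOf

/-- Turns an induction hypothesis about a suspended call into a rewrite rule: forcing the call
yields two encoded trees, about which only the opaque relation `Q` is known. -/
theorem ev_letPair_snd {R : Tm} {Q : BinaryTree (Key A) → BinaryTree (Key A) → Prop}
    (hR : ∀ v, Ev R v ↔ ∃ a b, v = .pair (enc a) (enc b) ∧ Q a b) {M N v : Tm} {k' : ℕ∞}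
    {x y : ℕ} : Ev (.letPair k' x y (.snd (.lazyPair M R)) N) v ↔
      ∃ a b, Q a b ∧ Ev ((N.subst y (enc b)).subst x (enc a)) v := by
  simp [ev_letPair, hR]

theorem emp_eq_enc (A : Ty) : Tm.emp = enc (.nil : BinaryTree (Key A)) := rfl

/-- Folds a child rebuilt from its parts back into the form `enc _`, the only form of argument that
`run_newNode` recognises; `emp_eq_enc` does the same for empty subtrees. -/
theorem node_eq_enc (k : Key A) (l r : BinaryTree (Key A)) :
    Tm.node (.pack (.ofNat (phi (l.numNodes + r.numNodes + 1)))
      (.save ⊤ (.ofNat (phi (l.numNodes + r.numNodes + 1))) k.1))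
      (num (l.numNodes + r.numNodes + 1)) (enc l) (enc r) = enc (.node k l r) := rfl

/-- Both outcomes of each comparison are followed, and each regrouping preserves the symmetric
order. Hence `cmp` need only be a closed value, and no ordering of the keys is assumed. -/
theorem run_split {cmp : Tm} (hc : Closed cmp) (hv : cmp.IsValue) (p : Key A)
    {t : BinaryTree (Key A)} {v : Tm}
    (h : Run (split cmp) (.pair (.save ⊤ (Credit.ofNat 0) p.1) (enc t)) v) :
    ∃ a b, v = .pair (enc a) (enc b) ∧ inorder a ++ inorder b = inorder t := by
  have hev := fun v => hv.ev (w := v)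
  have hcs : ∀ d S, Scoped d S cmp := fun d S => hc.scoped
  have hns : ∀ d S, Scoped d S newNode := fun d S => closed_newNode.scoped
  revert h
  simp only [split, run_lam, bindRoot, openKey, ifLe, sameRoot, bindLeft, bindRight, goLeft, goRight,
    leftChild, rightChild, mk]
  simp [hc]
  refine trec_enc_cases
    (fun M => Ev M v → ∃ a b, v = .pair (enc a) (enc b) ∧ inorder a ++ inorder b = inorder t)
    ?_ ?_ ?_ ?_ ?_ fun R hR h => ?_
  case refine_6 =>
    -- Induction on the number of nodes, since the recursive calls are made on grandchildren.
    induction hn : t.numNodes using Nat.strong_induction_on generalizing t v with | _ n ih =>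
    subst hn
    have key : ∀ s : BinaryTree (Key A), s.numNodes < t.numNodes →
        ∃ Q : BinaryTree (Key A) → BinaryTree (Key A) → Prop,
          (∀ v, Ev (R s) v ↔ ∃ a b, v = .pair (enc a) (enc b) ∧ Q a b) ∧
          ∀ a b, Q a b → inorder a ++ inorder b = inorder s := by
      intro s hs
      -- `Q` bundles the actual results of the call with the property from the induction hypothesis,
      -- which makes the evaluation clause an equivalence.
      refine ⟨fun a b => Ev (R s) (.pair (enc a) (enc b)) ∧ inorder a ++ inorder b = inorder s,
        fun v => ⟨fun hv => ?_, ?_⟩, fun a b h => h.2⟩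
      · obtain ⟨a, b, rfl, hab⟩ := ih _ hs rfl hv
        exact ⟨a, b, rfl, hv, hab⟩
      · rintro ⟨a, b, rfl, hv, -⟩
        exact hv
    rw [h]
    clear h ih
    rcases t with _ | ⟨k, _ | ⟨k', l, r⟩, _ | ⟨k'', l', r'⟩⟩
    · simp only [encUnfold]
      simp
      rintro rfl
      exact ⟨.nil, .nil, rfl, rfl⟩
    · simp only [encUnfold]
      simp [hc, hev, emp_eq_enc A]
      -- The discarded components record what the comparison returned; they are not needed, here or
      -- in the cases below.
      rintro (⟨-, rfl⟩ | ⟨-, rfl⟩)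
      · exact ⟨.nil, .node k .nil .nil, rfl, by simp [inorder]⟩
      · exact ⟨.node k .nil .nil, .nil, rfl, by simp [inorder]⟩
    · obtain ⟨Q, hQ, hQk⟩ := key l' (by simp [BinaryTree.numNodes]; omega)
      obtain ⟨Q', hQ', hQk'⟩ := key r' (by simp [BinaryTree.numNodes]; omega)
      simp only [encUnfold, encChild]
      simp [hc, hev, hR, ev_letPair_snd hQ, ev_letPair_snd hQ', emp_eq_enc A]
      rintro (⟨-, rfl⟩ | ⟨-, ⟨-, a, b, hab, rfl⟩ | ⟨-, a, b, hab, rfl⟩⟩)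
      · exact ⟨.nil, .node k .nil (.node k'' l' r'), by simp [enc, BinaryTree.numNodes], rfl⟩
      · exact ⟨_, _, rfl, by simp [inorder, ← hQk _ _ hab]⟩
      · exact ⟨_, _, rfl, by simp [inorder, ← hQk' _ _ hab]⟩
    · obtain ⟨Q, hQ, hQk⟩ := key l (by simp [BinaryTree.numNodes]; omega)
      obtain ⟨Q', hQ', hQk'⟩ := key r (by simp [BinaryTree.numNodes]; omega)
      simp only [encUnfold, encChild]
      simp [hc, hev, hR, ev_letPair_snd hQ, ev_letPair_snd hQ', emp_eq_enc A]
      rintro (⟨-, ⟨-, a, b, hab, rfl⟩ | ⟨-, a, b, hab, rfl⟩⟩ | ⟨-, rfl⟩)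
      · exact ⟨_, _, rfl, by simp [inorder, ← hQk _ _ hab]⟩
      · exact ⟨_, _, rfl, by simp [inorder, ← hQk' _ _ hab]⟩
      · exact ⟨.node k (.node k' l r) .nil, .nil, by simp [enc, BinaryTree.numNodes],
          by simp [inorder]⟩
    · obtain ⟨Q₁, hQ₁, hk₁⟩ := key l (by simp [BinaryTree.numNodes]; omega)
      obtain ⟨Q₂, hQ₂, hk₂⟩ := key r (by simp [BinaryTree.numNodes]; omega)
      obtain ⟨Q₃, hQ₃, hk₃⟩ := key l' (by simp [BinaryTree.numNodes]; omega)
      obtain ⟨Q₄, hQ₄, hk₄⟩ := key r' (by simp [BinaryTree.numNodes]; omega)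
      simp only [encUnfold, encChild]
      simp [hc, hev, hR, ev_letPair_snd hQ₁, ev_letPair_snd hQ₂, ev_letPair_snd hQ₃,
        ev_letPair_snd hQ₄, node_eq_enc]
      rintro (⟨-, ⟨-, a, b, hab, rfl⟩ | ⟨-, a, b, hab, rfl⟩⟩ |
        ⟨-, ⟨-, a, b, hab, rfl⟩ | ⟨-, a, b, hab, rfl⟩⟩)
      · exact ⟨_, _, rfl, by simp [inorder, ← hk₁ _ _ hab]⟩
      · exact ⟨_, _, rfl, by simp [inorder, ← hk₂ _ _ hab]⟩
      · exact ⟨_, _, rfl, by simp [inorder, ← hk₃ _ _ hab]⟩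
      · exact ⟨_, _, rfl, by simp [inorder, ← hk₄ _ _ hab]⟩
  all_goals simp [hcs, hns]

end split

/-! ## Splay trees as trees of keys -/

/-- Typing inversion bounds the resources of a component by those of the whole. Below a bank there
are only banks, so the components of a closed value are again closed values. -/
theorem Res.eq_bank_of_le {f : Res} {a : ℕ∞} (h : f ≤ Res.bank a) : ∃ b, f = Res.bank b := by
  obtain ⟨f₁, f₂, b⟩ := f
  obtain ⟨h₁, h₂, -⟩ := h
  exact ⟨b, Prod.ext (le_antisymm h₁ fun _ => zero_le)
    (Prod.ext (le_antisymm h₂ fun _ => zero_le) rfl)⟩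

theorem Res.bank_add (a b : ℕ∞) : Res.bank a + Res.bank b = Res.bank (a + b) := by
  simp [Res.bank]

theorem Res.le_add_left (f g : Res) : f ≤ g + f :=
  ⟨fun _ => le_add_self, fun _ => le_add_self, le_add_self⟩

theorem Res.le_add_right (f g : Res) : f ≤ f + g :=
  ⟨fun _ => le_self_add, fun _ => le_self_add, le_self_add⟩

theorem Res.le_top_smul (f : Res) : f ≤ (⊤ : ℕ∞) • f := by
  have h : ∀ a : ℕ∞, a ≤ ⊤ * a := fun a => by
    simpa using mul_le_mul_left (le_top : (1 : ℕ∞) ≤ ⊤) a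
  exact ⟨fun _ => h _, fun _ => h _, h _⟩

/-! ### Canonical forms of typed tree values -/

theorem eq_emp_or_node {d : ℕ} {Γ : Ctx} {f : Res} {t : Tm} {B : Ty} (hv : t.IsValue)
    (h : HasType d Γ f t (.tree B)) : t = .emp ∨ ∃ e m l r, t = .node e m l r ∧
      e.IsValue ∧ l.IsValue ∧ r.IsValue ∧ (∃ g, g ≤ f ∧ HasType d Γ g e B) ∧
      (∃ g, g ≤ f ∧ HasType d Γ g l (.tree B)) ∧ (∃ g, g ≤ f ∧ HasType d Γ g r (.tree B)) := by
  cases hv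
  case node he hm hl hr =>
    cases h with | node h₁ h₂ h₃ h₄ =>
    refine .inr ⟨_, _, _, _, rfl, he, hl, hr, ⟨_, ?_, h₁⟩, ⟨_, ?_, h₃⟩, ⟨_, ?_, h₄⟩⟩
    · simp only [add_assoc]
      exact Res.le_add_right _ _
    · exact (Res.le_add_left _ _).trans (Res.le_add_right _ _)
    · exact Res.le_add_left _ _
  case emp => exact .inl rfl
  all_goals cases h

/-- The same `n` occurs twice because packing instantiates the credit variable annotating the saved
key. As `A` is closed, that instantiation leaves `A` itself alone. -/
theorem exists_elem {d : ℕ} {Γ : Ctx} {f : Res} {e : Tm} {A : Ty} (hA : A.WF 0) (hv : e.IsValue)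
    (h : HasType d Γ f e (.ex (.bang ⊤ (Credit.cvar 0) A.shift))) :
    ∃ n v, e = .pack (.ofNat n) (.save ⊤ (.ofNat n) v) ∧ v.IsValue ∧
      ∃ g, g ≤ f ∧ HasType d Γ g v A := by
  have hs : ∀ σ, A.subst σ = A := fun σ =>
    Ty.subst_of_WF hA fun _ hi => (Nat.not_lt_zero _ hi).elim
  cases hv <;> cases h
  case pack n u hv hWF hWF' h =>
    rw [Ty.subst, Ty.shift, hs, hs, Credit.cvar_subst, Credit.inst_zero] at h
    cases hv <;> cases h
    case save v hv g _ _ hle h =>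
      -- A value saved with multiplicity `⊤` has its resources scaled by `⊤`, which is at least `1`,
      -- so they stay below those of the whole.
      exact ⟨_, _, rfl, hv, _, (Res.le_top_smul _).trans ((Res.le_add_right _ _).trans hle), h⟩

/-! ### Splay trees are the encodings of ordered trees -/

section

variable {A : Ty}

theorem treeSize_enc (t : BinaryTree (Key A)) : treeSize (enc t) = t.numNodes := by
  induction t with
  | nil => rfl
  | node k l r ihl ihr => simp [enc, treeSize, BinaryTree.numNodes, ihl, ihr]

theorem treeKeys_enc (t : BinaryTree (Key A)) :
    treeKeys (enc t) = (inorder t).map Subtype.val := by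
  induction t with
  | nil => rfl
  | node k l r ihl ihr => simp [enc, treeKeys, inorder, elem, elemKey, ihl, ihr]

theorem creditInvariant_enc (t : BinaryTree (Key A)) : CreditInvariant (enc t) := by
  induction t with
  | nil => trivial
  | node k l r ihl ihr =>
    simp [enc, CreditInvariant, elem, elemCredit, ihl, ihr, treeSize_enc]

theorem hasType_num (n : ℕ) (d : ℕ) (Γ : Ctx) (f : Res) : HasType d Γ f (num n) .nat := by
  induction n with
  | zero => exact .zero
  | succ n ih => exact .succ ih

theorem Ty.WF.mono {B : Ty} {d d' : ℕ} (hd : d ≤ d') (h : B.WF d) : B.WF d' := by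
  induction B generalizing d d' <;> simp only [Ty.WF] at h ⊢ <;> grind [Credit.WF.mono]

theorem wf_splayElem (hA : A.WF 0) : (Ty.ex (.bang ⊤ (Credit.cvar 0) A.shift)).WF 0 := by
  rw [Ty.shift, Ty.subst_of_WF hA fun _ hi => (Nat.not_lt_zero _ hi).elim]
  exact ⟨by simp, by simp, hA.mono (Nat.zero_le 1)⟩

theorem hasType_elem (hA : A.WF 0) (k : Key A) (n : ℕ) :
    HasType 0 Ctx.empty (Res.bank ⊤) (elem k n) (.ex (.bang ⊤ (Credit.cvar 0) A.shift)) := by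
  have hs : ∀ σ, A.subst σ = A := fun σ =>
    Ty.subst_of_WF hA fun _ hi => (Nat.not_lt_zero _ hi).elim
  obtain ⟨-, a, hk⟩ := k.2
  refine .pack (Credit.WF_ofNat _ _) ?_ ?_
  · exact wf_splayElem hA
  · rw [Ty.subst, Ty.shift, hs, hs, Credit.cvar_subst, Credit.inst_zero]
    -- The bank `⊤` absorbs both the `⊤`-fold resources of the key and the attached credits; the
    -- coefficients of all variables vanish.
    refine .save (by simp) (Credit.WF_ofNat _ _) hk ⟨?_, ?_, le_top⟩
    · simp [Res.bank, Res.ofCredit]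
    · intro i
      simp [Res.bank, Res.ofCredit, Credit.ofNat]

theorem isClosedValue_enc (hA : A.WF 0) (t : BinaryTree (Key A)) :
    IsClosedValue (splayTy A) (enc t) := by
  -- A closed value may use any number of credits, so the infinite bank can serve every node and is
  -- stable under addition.
  refine ⟨isValue_enc t, ⊤, ?_⟩
  induction t with
  | nil => exact .emp (wf_splayElem hA)
  | node k l r ihl ihr =>
    have := HasType.node (hasType_elem hA k (l.numNodes + r.numNodes + 1))
      (hasType_num (l.numNodes + r.numNodes + 1) 0 Ctx.empty (Res.bank 0)) ihl ihr
    simp only [Res.bank_add, add_top] at this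
    exact this

/-- Typing supplies the shape of the value and closed keys, and the credit invariant determines the
remaining data, namely sizes and credits. -/
theorem exists_eq_enc (hA : A.WF 0) {t : Tm} (ht : IsClosedValue (splayTy A) t)
    (hc : CreditInvariant t) : ∃ T : BinaryTree (Key A), t = enc T := by
  obtain ⟨hv, a, h⟩ := ht
  induction t generalizing a
  case node e m l r ihe ihm ihl ihr =>
    obtain h | ⟨e', m', l', r', heq, he, hl, hr, ⟨f₁, hf₁, h₁⟩, ⟨f₂, hf₂, h₂⟩, ⟨f₃, hf₃, h₃⟩⟩ :=
      eq_emp_or_node hv h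
    · cases h
    · cases heq
      obtain ⟨hcl, hcr, hm, hce⟩ := hc
      obtain ⟨a₂, rfl⟩ := Res.eq_bank_of_le hf₂
      obtain ⟨a₃, rfl⟩ := Res.eq_bank_of_le hf₃
      obtain ⟨L, rfl⟩ := ihl hcl hl _ h₂
      obtain ⟨R, rfl⟩ := ihr hcr hr _ h₃
      obtain ⟨n, v, rfl, hv, g, hg, hk⟩ := exists_elem hA he h₁
      obtain ⟨b, rfl⟩ := Res.eq_bank_of_le (hg.trans hf₁)
      refine ⟨.node ⟨v, hv, b, hk⟩ L R, ?_⟩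
      simp only [treeSize_enc] at hm hce
      simp only [elemCredit, Option.some.injEq, Credit.ofNat_inj] at hce
      rw [enc, elem, hm, hce]
  case emp => exact ⟨.nil, rfl⟩
  all_goals
    obtain h | ⟨_, _, _, _, h, -⟩ := eq_emp_or_node hv h <;> cases h

/-- A search tree compares keys only with the root above them; left and right keys are compared
through the root. Transitivity is asked only on closed values of type `A`, where the preorder laws
hold. -/
theorem isSearchTree_enc {R : Tm → Tm → Prop}
    (hR : ∀ u v w : Key A, R u.1 v.1 → R v.1 w.1 → R u.1 w.1) (t : BinaryTree (Key A)) :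
    IsSearchTree R (enc t) ↔ (inorder t).Pairwise fun u v => R u.1 v.1 := by
  induction t with
  | nil => simp [enc, IsSearchTree, inorder]
  | node k l r ihl ihr =>
    simp only [enc, IsSearchTree, inorder, List.pairwise_append, List.pairwise_cons, ihl, ihr,
      treeKeys_enc, elem, elemKey, List.mem_map, List.mem_cons]
    constructor
    · rintro ⟨hl, hr, hlk, hkr⟩
      refine ⟨hl, ⟨fun v hv => hkr _ ⟨v, hv, rfl⟩, hr⟩, ?_⟩
      rintro u hu v (rfl | hv)
      · exact hlk _ ⟨u, hu, rfl⟩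
      · exact hR u k v (hlk _ ⟨u, hu, rfl⟩) (hkr _ ⟨v, hv, rfl⟩)
    · rintro ⟨hl, ⟨hkr, hr⟩, h⟩
      refine ⟨hl, hr, ?_, ?_⟩
      · rintro _ ⟨u, hu, rfl⟩
        exact h u hu k (.inl rfl)
      · rintro _ ⟨u, hu, rfl⟩
        exact hkr u hu

theorem keyBefore_trans {distinct : Bool} {cmp : Tm} (hcmp : IsComparison A cmp) (u v w : Key A)
    (huv : KeyBefore distinct cmp u.1 v.1) (hvw : KeyBefore distinct cmp v.1 w.1) :
    KeyBefore distinct cmp u.1 w.1 := by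
  cases distinct with
  | false => exact hcmp.trans _ _ _ u.2 v.2 w.2 huv hvw
  | true =>
    intro h
    -- If `w ≤ u`, then totality turns `¬ v ≤ u` into `u ≤ v`, whence `w ≤ v`, against `hvw`.
    exact hvw (hcmp.trans _ _ _ w.2 u.2 v.2 h ((hcmp.total _ _ u.2 v.2).resolve_right huv))

theorem isSplayTree_enc (hA : A.WF 0) {distinct : Bool} {cmp : Tm} (hcmp : IsComparison A cmp)
    (t : BinaryTree (Key A)) : IsSplayTree distinct A cmp (enc t) ↔
      (inorder t).Pairwise fun u v => KeyBefore distinct cmp u.1 v.1 := by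
  rw [← isSearchTree_enc (keyBefore_trans hcmp)]
  exact ⟨fun h => h.searchTree, fun h => ⟨isClosedValue_enc hA t, h, creditInvariant_enc t⟩⟩

end

end LambdaA

/-! ### The splay-tree invariant -/

theorem mainTheorem11 (distinct : Bool) (A : LambdaA.Ty) (hA : A.WF 0)
    (cmp : LambdaA.Tm) (hcmp : LambdaA.IsComparison A cmp)
    (p : LambdaA.Tm) (hp : LambdaA.IsClosedValue A p)
    (t t₀ t₁ : LambdaA.Tm) (ht : LambdaA.IsSplayTree distinct A cmp t)
    (n : ℕ) (r : EReal)
    (hsplit : LambdaA.Eval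
      (.app (LambdaA.split cmp) (.pair (.save ⊤ (LambdaA.Credit.ofNat 0) p) t)) n r
      (.pair t₀ t₁)) :
    LambdaA.IsSplayTree distinct A cmp t₀ ∧ LambdaA.IsSplayTree distinct A cmp t₁ := by
  obtain ⟨T, rfl⟩ := LambdaA.exists_eq_enc hA ht.closedValue ht.credits
  rw [LambdaA.isSplayTree_enc hA hcmp] at ht
  obtain ⟨F, hF, u, hu, h⟩ := LambdaA.ev_app.1 ⟨n, r, hsplit⟩
  cases LambdaA.ev_lam.1 hF
  have harg : (LambdaA.Tm.pair (.save ⊤ (LambdaA.Credit.ofNat 0) p) (LambdaA.enc T)).IsValue :=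
    .pair (.save _ _ hp.1) (LambdaA.isValue_enc T)
  cases harg.ev.1 hu
  obtain ⟨a, b, hab, hk⟩ := LambdaA.run_split hcmp.hasType.closed hcmp.isValue ⟨p, hp⟩ h
  cases hab
  -- The ordered list of keys is the concatenation of those of the two results, so each result
  -- inherits the order.
  rw [← hk, List.pairwise_append] at ht
  exact ⟨(LambdaA.isSplayTree_enc hA hcmp _).2 ht.1, (LambdaA.isSplayTree_enc hA hcmp _).2 ht.2.1⟩
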